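/- There are absolute constants $0<c\le C<\infty$ such that the following holds for every integer $M\ge 4$ and every regular polygon $Q\subset\mathbb{R}^2$ with $M$ vertices. For each $n$, let $Q_n$ be the convex hull of $n$ independent random points, each uniformly distributed on the boundary $\partial Q$ (with respect to arc length), and let $\delta_H$ denote the Hausdorff distance. Then $\lim_{n\to\infty} n\,\mathbb{E}[\delta_H(Q,Q_n)]$ exists and $$c\,|\partial Q|\,\frac{\log M}{M}\;\le\;\lim_{n\to\infty} n\,\mathbb{E}[\delta_H(Q,Q_n)]\;\le\; C\,|\partial Q|\,\frac{\log M}{M},$$ where $|\partial Q|$ is the total length of the boundary of $Q$. -/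

import Mathlib

/-- The Euclidean plane `ℝ²`. -/
abbrev Plane : Type := EuclideanSpace ℝ (Fin 2)

/-- The point at angle `θ` on the circle with center `p` and radius `R`. -/
noncomputable def circlePoint (p : Plane) (R θ : ℝ) : Plane :=
  p + !₂[R * Real.cos θ, R * Real.sin θ]

/-- `Q` is a (solid, convex) regular polygon with `M` vertices: the convex hull of `M` equally
spaced points on a circle of positive radius, in arbitrary position in the plane. -/
def IsRegularPolygon (M : ℕ) (Q : Set Plane) : Prop :=
  ∃ (p : Plane) (R θ : ℝ), 0 < R ∧
    Q = convexHull ℝ (Set.range fun k : Fin M => circlePoint p R (θ + 2 * Real.pi * k / M))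

/-- The length `|∂Q|` of the boundary of `Q`: its one-dimensional Hausdorff measure. -/
noncomputable def boundaryLength (Q : Set Plane) : ℝ :=
  (MeasureTheory.Measure.hausdorffMeasure 1 : MeasureTheory.Measure Plane).real (frontier Q)

/-- `X 0, …, X (n - 1)` are independent random points, each uniformly distributed on the boundary
of `Q`, i.e. with law the normalized arc length measure on the boundary. -/
structure IsUniformBoundarySample {Ω : Type*} [MeasurableSpace Ω]
    (P : MeasureTheory.Measure Ω) (Q : Set Plane) {n : ℕ} (X : Fin n → Ω → Plane) : Prop where
  measurable : ∀ i, Measurable (X i)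
  indep : ProbabilityTheory.iIndepFun X P
  uniform : ∀ i, MeasureTheory.pdf.IsUniform (X i) (frontier Q) P
    (MeasureTheory.Measure.hausdorffMeasure 1)

/-- The Hausdorff distance `δ_H(Q, [X₁, …, Xₙ])` between `Q` and the convex hull of the random
points, as a random variable. -/
noncomputable def hullDist {Ω : Type*} (Q : Set Plane) {n : ℕ} (X : Fin n → Ω → Plane)
    (ω : Ω) : ℝ :=
  Metric.hausdorffDist Q (convexHull ℝ (Set.range fun i => X i ω))

open MeasureTheory Filter Topology Set ProbabilityTheory

/-! The Hausdorff distance from a polytope to a convex subset is attained at a vertex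
(`hausdorffDist_convexHull_range_eq_iSup`). Once every side carries a sample point other than its
far vertex, the distance from a vertex to the hull depends only on the nearest sample points on its
two sides: it is the distance to the segment joining them (`infDist_convexHull_eq_cornerDist`). So,
off an event of exponentially small probability, the Hausdorff distance is a fixed continuous
homogeneous function, `maxCornerDist`, of 2M nearest-point coordinates.

By independence the coordinates have joint survival function (1 - (∑ sᵢ⁺)/M)ⁿ. After scaling by n
this tends to exp(-(∑ aᵢ⁺)/M), so the scaled coordinates converge weakly to 2M independent
exponential variables of rate 1/M. Exponential tails uniform in n carry the convergence over to
expectations (`tendsto_integral_of_exp_tail`), and the limit is the mean of `maxCornerDist` under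
`expPi`.

With D the norm of the sum of the two edge vectors at a vertex, a corner cut at fractions a and b
has distance between min(a, b)·D/2 and min(a, b)·D. Each minimum is exponential of rate 2/M, and the
maximum of M independent ones has mean of order M log M. For side length ℓ, D = 2ℓ sin(π/M) is of
order ℓ/M, so the limit is of order ℓ log M = |∂Q| log M / M. -/

/-! ### Weak convergence and passage to the limit in expectations. -/

theorem tendsto_measureReal_of_tendsto_survival {ι : Type*} [Finite ι]
    {μ : ℕ → Measure (ι → ℝ)} {ν : Measure (ι → ℝ)} [∀ n, IsProbabilityMeasure (μ n)]
    [IsProbabilityMeasure ν]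
    (h : ∀ a : ι → ℝ, Tendsto (fun n => (μ n).real {x | ∀ i, a i < x i}) atTop
      (𝓝 (ν.real {x | ∀ i, a i < x i}))) (b : ι → ℝ) (s : Finset ι) (a : ι → ℝ) :
    Tendsto (fun n => (μ n).real {x | (∀ i, a i < x i) ∧ ∀ i ∈ s, x i ≤ b i}) atTop
      (𝓝 (ν.real {x | (∀ i, a i < x i) ∧ ∀ i ∈ s, x i ≤ b i})) := by
  classical
  have meas : ∀ (s : Finset ι) (a : ι → ℝ),
      MeasurableSet {x : ι → ℝ | (∀ i, a i < x i) ∧ ∀ i ∈ s, x i ≤ b i} := by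
    intro s a
    refine MeasurableSet.inter ?_ ?_
    · change MeasurableSet {x : ι → ℝ | ∀ i, a i < x i}
      simp only [ofPred_forall]
      exact MeasurableSet.iInter fun i => measurableSet_lt measurable_const (measurable_pi_apply i)
    · change MeasurableSet {x : ι → ℝ | ∀ i ∈ s, x i ≤ b i}
      simp only [ofPred_forall]
      exact MeasurableSet.iInter fun i => MeasurableSet.iInter fun _ =>
        measurableSet_le (measurable_pi_apply i) measurable_const
  induction s using Finset.induction_on generalizing a with
  | empty => simpa using h a
  | insert i s hi ih =>
    -- One upper bound is traded for a difference of two sets with fewer upper bounds. Taking the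
    -- maximum, and not `b i` alone, keeps the subtracted set inside the first when `b i < a i`.
    have key : {x : ι → ℝ | (∀ j, a j < x j) ∧ ∀ j ∈ insert i s, x j ≤ b j} =
        {x | (∀ j, a j < x j) ∧ ∀ j ∈ s, x j ≤ b j} \
        {x | (∀ j, Function.update a i (max (a i) (b i)) j < x j) ∧ ∀ j ∈ s, x j ≤ b j} := by
      ext x
      simp only [mem_ofPred_eq, Finset.mem_insert, forall_eq_or_imp, Set.mem_sdiff, not_and]
      constructor
      · rintro ⟨h1, h2, h3⟩
        refine ⟨⟨h1, h3⟩, fun h4 => ?_⟩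
        have := h4 i
        simp only [Function.update_self, max_lt_iff] at this
        exact absurd h2 (not_le.2 this.2)
      · rintro ⟨⟨h1, h3⟩, h4⟩
        refine ⟨h1, ?_, h3⟩
        by_contra! hb
        refine h4 (fun j => ?_) h3
        rcases eq_or_ne j i with rfl | hj
        · simp [h1 j, hb]
        · simp [hj, h1 j]
    have sub : {x : ι → ℝ | (∀ j, Function.update a i (max (a i) (b i)) j < x j) ∧
        ∀ j ∈ s, x j ≤ b j} ⊆ {x | (∀ j, a j < x j) ∧ ∀ j ∈ s, x j ≤ b j} := by
      rintro x ⟨h1, h2⟩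
      refine ⟨fun j => lt_of_le_of_lt ?_ (h1 j), h2⟩
      rcases eq_or_ne j i with rfl | hj
      · simp
      · simp [hj]
    rw [key, measureReal_sdiff sub (meas _ _)]
    have : ∀ n, (μ n).real ({x | (∀ j, a j < x j) ∧ ∀ j ∈ s, x j ≤ b j} \
        {x | (∀ j, Function.update a i (max (a i) (b i)) j < x j) ∧ ∀ j ∈ s, x j ≤ b j}) =
        (μ n).real {x | (∀ j, a j < x j) ∧ ∀ j ∈ s, x j ≤ b j} - (μ n).real
        {x | (∀ j, Function.update a i (max (a i) (b i)) j < x j) ∧ ∀ j ∈ s, x j ≤ b j} :=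
      fun n => measureReal_sdiff sub (meas _ _)
    simp only [this]
    exact (ih a).sub (ih _)

/-- Probability measures on `ℝ^ι` converge weakly if their survival functions converge. -/
theorem tendsto_probabilityMeasure_of_tendsto_survival {ι : Type*} [Finite ι]
    {μ : ℕ → ProbabilityMeasure (ι → ℝ)} {ν : ProbabilityMeasure (ι → ℝ)}
    (h : ∀ a : ι → ℝ, Tendsto (fun n => (μ n : Measure (ι → ℝ)).real {x | ∀ i, a i < x i}) atTop
      (𝓝 ((ν : Measure (ι → ℝ)).real {x | ∀ i, a i < x i}))) :
    Tendsto μ atTop (𝓝 ν) := by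
  have := Fintype.ofFinite ι
  -- Half-open boxes form a π-system containing small neighbourhoods of every point, so convergence
  -- on them suffices.
  let S : Set (Set (ι → ℝ)) := {t | ∃ a b : ι → ℝ, t = univ.pi fun i => Ioc (a i) (b i)}
  have hS : IsPiSystem S := by
    rintro _ ⟨a, b, rfl⟩ _ ⟨a', b', rfl⟩ -
    refine ⟨a ⊔ a', b ⊓ b', ?_⟩
    rw [← pi_inter_distrib]
    simp [Ioc_inter_Ioc]
  refine hS.tendsto_probabilityMeasure_of_tendsto_of_mem ?_ ?_ ?_
  · rintro _ ⟨a, b, rfl⟩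
    exact MeasurableSet.univ_pi fun i => measurableSet_Ioc
  · intro u hu x hx
    obtain ⟨ε, hε, hb⟩ := Metric.isOpen_iff.1 hu x hx
    refine ⟨_, ⟨fun i => x i - ε / 2, fun i => x i + ε / 2, rfl⟩, ?_, ?_⟩
    · exact set_pi_mem_nhds finite_univ fun i _ =>
        Ioc_mem_nhds (by linarith) (by linarith)
    · refine Subset.trans ?_ hb
      intro y hy
      rw [Metric.mem_ball]
      refine lt_of_le_of_lt ((dist_pi_le_iff (by linarith : 0 ≤ ε / 2)).2 fun i => ?_)
        (half_lt_self hε)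
      have := hy i (mem_univ i)
      rw [Real.dist_eq, abs_le]
      constructor <;> linarith [this.1, this.2]
  · rintro _ ⟨a, b, rfl⟩
    have e : (univ.pi fun i => Ioc (a i) (b i)) =
        {x | (∀ i, a i < x i) ∧ ∀ i ∈ (Finset.univ : Finset ι), x i ≤ b i} := by
      ext x
      simp [forall_and]
    have := tendsto_measureReal_of_tendsto_survival h b Finset.univ a
    rw [← e] at this
    rw [← NNReal.tendsto_coe]
    exact this

/-- An exponential tail bound gives integrability and a bound on the error of truncation. -/
theorem integrable_and_integral_le_of_exp_tail {E : Type*} [MeasurableSpace E] {μ : Measure E}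
    [IsProbabilityMeasure μ] {F : E → ℝ} (hF : Measurable F) (h0 : ∀ x, 0 ≤ F x) {C c K : ℝ}
    (hC : 0 ≤ C) (hc : 0 < c) (hK : 0 ≤ K)
    (h : ∀ t, 0 < t → μ.real {x | t < F x} ≤ C * Real.exp (-c * t)) :
    Integrable F μ ∧
      ∫ x, F x ∂μ ≤ ∫ x, min (F x) K ∂μ + C / c * Real.exp (-c * K) := by
  -- Only the excess of `F` over `K` needs the tail bound; its integral is computed by the
  -- layer-cake formula.
  set G : E → ℝ := fun x => max (F x - K) 0 with hG
  have hGm : Measurable G := (hF.sub_const K).max measurable_const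
  have hG0 : ∀ x, 0 ≤ G x := fun x => le_max_right _ _
  have hsplit : ∀ x, F x = min (F x) K + G x := by
    intro x
    simp only [hG]
    rcases le_total (F x) K with h | h
    · rw [min_eq_left h, max_eq_right (by linarith)]; ring
    · rw [min_eq_right h, max_eq_left (by linarith)]; ring
  have hexp : Integrable (fun t => C * Real.exp (-c * K) * Real.exp (-c * t))
      (volume.restrict (Ioi 0)) :=
    (exp_neg_integrableOn_Ioi 0 hc).const_mul _
  have hval : ∫ t in Ioi (0 : ℝ), C * Real.exp (-c * K) * Real.exp (-c * t) =
      C / c * Real.exp (-c * K) := by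
    rw [integral_const_mul, integral_exp_mul_Ioi (by linarith : -c < 0)]
    field_simp
    simp
  have hlin : ∫⁻ x, ENNReal.ofReal (G x) ∂μ ≤ ENNReal.ofReal (C / c * Real.exp (-c * K)) := by
    rw [lintegral_eq_lintegral_meas_lt μ (Eventually.of_forall hG0) hGm.aemeasurable, ← hval,
      ofReal_integral_eq_lintegral_ofReal hexp (Eventually.of_forall fun t => by positivity)]
    refine setLIntegral_mono' measurableSet_Ioi fun t ht => ?_
    have ht : 0 < t := ht
    rw [← ENNReal.ofReal_toReal (measure_ne_top μ {a | t < G a})]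
    refine ENNReal.ofReal_le_ofReal ?_
    have e : {a | t < G a} = {a | K + t < F a} := by
      ext a
      simp only [hG, mem_ofPred_eq, lt_max_iff]
      constructor
      · rintro (h | h) <;> linarith
      · intro h; left; linarith
    rw [e]
    refine (h (K + t) (by linarith)).trans (le_of_eq ?_)
    rw [mul_assoc, ← Real.exp_add]
    ring_nf
  have hGi : Integrable G μ := by
    refine ⟨hGm.aestronglyMeasurable, ?_⟩
    rw [hasFiniteIntegral_iff_ofReal (Eventually.of_forall hG0)]
    exact hlin.trans_lt ENNReal.ofReal_lt_top
  have hmin : Integrable (fun x => min (F x) K) μ := by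
    refine Integrable.of_bound (hF.min measurable_const).aestronglyMeasurable K
      (Eventually.of_forall fun x => ?_)
    rw [Real.norm_of_nonneg (le_min (h0 x) hK)]
    exact min_le_right _ _
  have hFe : F = fun x => min (F x) K + G x := funext hsplit
  refine ⟨?_, ?_⟩
  · rw [hFe]; exact hmin.add hGi
  · conv_lhs => rw [hFe]
    rw [integral_add hmin hGi]
    gcongr
    rw [integral_eq_lintegral_of_nonneg_ae (Eventually.of_forall hG0) hGm.aestronglyMeasurable]
    exact ENNReal.toReal_le_of_le_ofReal (by positivity) hlin

/-- Weak convergence and uniform exponential tails give convergence of the integrals of an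
unbounded continuous function. -/
theorem tendsto_integral_of_exp_tail {E : Type*} [TopologicalSpace E] [MeasurableSpace E]
    [OpensMeasurableSpace E] {μ : ℕ → ProbabilityMeasure E} {ν : ProbabilityMeasure E}
    (hμ : Tendsto μ atTop (𝓝 ν)) {F : E → ℝ} (hF : Continuous F) (h0 : ∀ x, 0 ≤ F x) {C c : ℝ}
    (hC : 0 ≤ C) (hc : 0 < c)
    (h : ∀ᶠ n in atTop, ∀ t, 0 < t →
      (μ n : Measure E).real {x | t < F x} ≤ C * Real.exp (-c * t))
    (hν : ∀ t, 0 < t → (ν : Measure E).real {x | t < F x} ≤ C * Real.exp (-c * t)) :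
    Tendsto (fun n => ∫ x, F x ∂(μ n : Measure E)) atTop (𝓝 (∫ x, F x ∂(ν : Measure E))) := by
  rw [Metric.tendsto_atTop']
  intro ε hε
  -- The truncation error is the same for all the measures, so one level `K` serves every large n
  -- and the limit.
  obtain ⟨K, hK0, hK⟩ : ∃ K, 0 ≤ K ∧ C / c * Real.exp (-c * K) < ε / 3 := by
    have : Tendsto (fun K => C / c * Real.exp (-c * K)) atTop (𝓝 (C / c * 0)) := by
      refine Tendsto.const_mul _ (Real.tendsto_exp_atBot.comp ?_)
      exact tendsto_id.const_mul_atTop_of_neg (by linarith)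
    rw [mul_zero] at this
    obtain ⟨K, h1, h2⟩ :=
      ((eventually_ge_atTop (0 : ℝ)).and
        (this.eventually_lt_const (u := ε / 3) (by positivity))).exists
    exact ⟨K, h1, h2⟩
  let f : BoundedContinuousFunction E ℝ := BoundedContinuousFunction.ofNormedAddCommGroup
    (fun x => min (F x) K) (hF.min continuous_const) K (fun x => by
      rw [Real.norm_of_nonneg (le_min (h0 x) hK0)]; exact min_le_right _ _)
  have hf := (ProbabilityMeasure.tendsto_iff_forall_integral_tendsto.1 hμ) f
  have hle : ∀ (m : Measure E) [IsProbabilityMeasure m], Integrable F m →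
      ∫ x, f x ∂m ≤ ∫ x, F x ∂m := fun m _ hi =>
    integral_mono (f.integrable m) hi fun x => min_le_left _ _
  obtain ⟨iν, bν⟩ := integrable_and_integral_le_of_exp_tail hF.measurable h0 hC hc hK0 hν
  have lν := hle _ iν
  have hf' := Metric.tendsto_nhds.1 hf (ε / 3) (by positivity)
  obtain ⟨N, hN⟩ := eventually_atTop.1 (h.and hf')
  refine ⟨N, fun n hn => ?_⟩
  obtain ⟨h1, h2⟩ := hN n hn.le
  obtain ⟨iμ, bμ⟩ := integrable_and_integral_le_of_exp_tail hF.measurable h0 hC hc hK0 h1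
  have lμ := hle _ iμ
  have e : ∀ m : Measure E, ∫ x, f x ∂m = ∫ x, min (F x) K ∂m := fun m => rfl
  rw [Real.dist_eq, abs_lt] at h2 ⊢
  rw [e, e] at h2
  rw [e] at lμ lν
  constructor <;> linarith [h2.1, h2.2]

/-! ### Distances to convex hulls and the geometry of one corner. -/

/-- Exhibits the hull as the image of a fixed compact set under a map continuous in the points,
which makes distances to the hull continuous, hence measurable, in the sample. -/
theorem convexHull_range_eq_image_stdSimplex {ι E : Type*} [Fintype ι] [AddCommGroup E]
    [Module ℝ E] (x : ι → E) :
    convexHull ℝ (range x) = (fun w : ι → ℝ => ∑ i, w i • x i) '' stdSimplex ℝ ι := by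
  classical
  have e : (fun w : ι → ℝ => ∑ i, w i • x i) = Fintype.linearCombination ℝ x := by
    ext w; simp [Fintype.linearCombination_apply]
  rw [e, ← convexHull_basis_eq_stdSimplex, LinearMap.image_convexHull, ← range_comp]
  congr 2
  ext i
  simp [Fintype.linearCombination_apply]

theorem continuous_infDist_image {X Y E : Type*} [TopologicalSpace X] [TopologicalSpace Y]
    [PseudoMetricSpace E] {K : Set Y} (hK : IsCompact K) (v : E) {f : X → Y → E}
    (hf : Continuous ↿f) : Continuous fun x => Metric.infDist v (f x '' K) := by
  have : ∀ x, Metric.infDist v (f x '' K) = sInf ((fun y => dist v (f x y)) '' K) := by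
    intro x
    rw [Metric.infDist_eq_iInf, iInf, range_comp' (fun y => dist v y), Subtype.range_coe,
      image_image]
  simp only [this]
  exact hK.continuous_sInf (continuous_const.dist hf)

theorem continuous_infDist_convexHull_range {ι E : Type*} [Fintype ι] [NormedAddCommGroup E]
    [NormedSpace ℝ E] (v : E) :
    Continuous fun x : ι → E => Metric.infDist v (convexHull ℝ (range x)) := by
  simp only [convexHull_range_eq_image_stdSimplex]
  refine continuous_infDist_image (isCompact_stdSimplex ℝ ι) v ?_
  dsimp [Function.HasUncurry.uncurry]
  fun_prop

section CornerDist

variable {E : Type*} [NormedAddCommGroup E] [NormedSpace ℝ E]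

/-- The distance from the apex of a corner with edge vectors `u` and `w` to the segment that cuts
off the fractions `a` and `b` of the two edges. -/
noncomputable def cornerDist (u w : E) (a b : ℝ) : ℝ :=
  Metric.infDist 0 (segment ℝ (a • u) (b • w))

theorem cornerDist_nonneg (u w : E) (a b : ℝ) : 0 ≤ cornerDist u w a b := Metric.infDist_nonneg

theorem continuous_cornerDist (u w : E) : Continuous fun p : ℝ × ℝ => cornerDist u w p.1 p.2 := by
  simp only [cornerDist, segment_eq_image]
  refine continuous_infDist_image isCompact_Icc 0 ?_
  dsimp [Function.HasUncurry.uncurry]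
  fun_prop

/-- This homogeneity lets the factor n be absorbed into the coordinates. -/
theorem cornerDist_mul (u w : E) {c : ℝ} (hc : 0 < c) (a b : ℝ) :
    cornerDist u w (c * a) (c * b) = c * cornerDist u w a b := by
  have h := infDist_smul₀ hc.ne' (segment ℝ (a • u) (b • w)) 0
  rw [smul_zero, Real.norm_of_nonneg hc.le] at h
  rw [cornerDist, cornerDist, ← h]
  congr 1
  rw [← image_smul]
  have := image_segment ℝ (c • LinearMap.id : E →ₗ[ℝ] E).toAffineMap (a • u) (b • w)
  simp only [LinearMap.coe_toAffineMap, LinearMap.smul_apply, LinearMap.id_apply] at this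
  rw [mul_smul, mul_smul, ← this]

theorem cornerDist_le (u w : E) {a b : ℝ} (ha : 0 ≤ a) (hb : 0 ≤ b) :
    cornerDist u w a b ≤ min a b * ‖u + w‖ := by
  have key : ∀ p ∈ segment ℝ (a • u) (b • w), cornerDist u w a b ≤ ‖p‖ := by
    intro p hp
    have := Metric.infDist_le_dist_of_mem (x := 0) hp
    rwa [dist_zero_left] at this
  rcases (add_nonneg ha hb).eq_or_lt with h | h
  · obtain rfl : a = 0 := by linarith
    obtain rfl : b = 0 := by linarith
    simpa using key 0 (by simp)
  -- The weights are those of the point where the segment meets the line spanned by `u + w`; its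
  -- coefficient ab/(a + b) is at most min a b.
  · have hm : (b / (a + b)) • (a • u) + (a / (a + b)) • (b • w) ∈
        segment ℝ (a • u) (b • w) := by
      refine ⟨_, _, by positivity, by positivity, ?_, rfl⟩
      field_simp
      ring
    refine (key _ hm).trans ?_
    have e : (b / (a + b)) • (a • u) + (a / (a + b)) • (b • w) = (a * b / (a + b)) • (u + w) := by
      rw [smul_smul, smul_smul, smul_add]
      congr 2 <;> ring
    rw [e, norm_smul, Real.norm_of_nonneg (by positivity)]
    gcongr
    refine le_min ?_ ?_
    · rw [div_le_iff₀ h]; nlinarith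
    · rw [div_le_iff₀ h]; nlinarith

/-- If all points lie in the corner and beyond the line through a point on each edge, then the
distance from the apex to their convex hull is the corresponding `cornerDist`. -/
theorem infDist_convexHull_eq_cornerDist {v u w : E} {S : Set E} {a b : ℝ} (ha : 0 ≤ a)
    (hb : 0 ≤ b) (hu : v + a • u ∈ S) (hw : v + b • w ∈ S)
    (hS : ∀ x ∈ S, ∃ α β : ℝ, 0 ≤ α ∧ 0 ≤ β ∧ a * b ≤ α * b + β * a ∧
      x = v + α • u + β • w) :
    Metric.infDist v (convexHull ℝ S) = cornerDist u w a b := by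
  have hseg : ∀ p ∈ segment ℝ (a • u) (b • w), v + p ∈ convexHull ℝ S := by
    rintro _ ⟨s, t, hs, ht, hst, rfl⟩
    have := convex_convexHull ℝ S (subset_convexHull ℝ S hu) (subset_convexHull ℝ S hw) hs ht hst
    convert! this using 1
    have : v = s • v + t • v := by rw [← add_smul, hst, one_smul]
    nth_rewrite 1 [this]
    simp only [smul_add]
    abel
  have hne : (convexHull ℝ S).Nonempty := ⟨_, subset_convexHull ℝ S hu⟩
  have hle : Metric.infDist v (convexHull ℝ S) ≤ cornerDist u w a b := by
    refine (Metric.le_infDist ⟨_, left_mem_segment ℝ _ _⟩).2 fun p hp => ?_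
    refine (Metric.infDist_le_dist_of_mem (hseg p hp)).trans (le_of_eq ?_)
    simp [dist_eq_norm]
  refine le_antisymm hle ?_
  -- If one fraction vanishes, the apex lies on the segment and both sides are zero.
  rcases ha.eq_or_lt with rfl | ha
  · have : cornerDist u w 0 b = 0 := by
      refine le_antisymm ?_ (cornerDist_nonneg _ _ _ _)
      have := cornerDist_le u w le_rfl hb
      rwa [min_eq_left hb, zero_mul] at this
    rw [this]; exact Metric.infDist_nonneg
  rcases hb.eq_or_lt with rfl | hb
  · have : cornerDist u w a 0 = 0 := by
      refine le_antisymm ?_ (cornerDist_nonneg _ _ _ _)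
      have := cornerDist_le u w ha.le le_rfl
      rwa [min_eq_right ha.le, zero_mul] at this
    rw [this]; exact Metric.infDist_nonneg
  -- The inequality is α/a + β/b ≥ 1 without denominators, a condition preserved by convex
  -- combinations.
  have hT : convexHull ℝ S ⊆ {x | ∃ α β : ℝ, 0 ≤ α ∧ 0 ≤ β ∧ a * b ≤ α * b + β * a ∧
      x = v + α • u + β • w} := by
    refine convexHull_min hS ?_
    rintro _ ⟨α, β, h1, h2, h3, rfl⟩ _ ⟨α', β', h1', h2', h3', rfl⟩ s t hs ht hst
    refine ⟨s * α + t * α', s * β + t * β', by positivity, by positivity, ?_, ?_⟩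
    · calc a * b = s * (a * b) + t * (a * b) := by rw [← add_mul, hst, one_mul]
        _ ≤ s * (α * b + β * a) + t * (α' * b + β' * a) := by gcongr
        _ = _ := by ring
    · have : v = s • v + t • v := by rw [← add_smul, hst, one_smul]
      nth_rewrite 3 [this]
      simp only [smul_add, add_smul, mul_smul]
      abel
  refine (Metric.le_infDist hne).2 fun x hx => ?_
  obtain ⟨α, β, h1, h2, h3, rfl⟩ := hT hx
  have hs : 0 < α * b + β * a := lt_of_lt_of_le (by positivity) h3
  -- This is where the ray from the apex to the given point crosses the segment, no farther from the
  -- apex than that point.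
  have hp : (α * b / (α * b + β * a)) • (a • u) + (β * a / (α * b + β * a)) • (b • w) ∈
      segment ℝ (a • u) (b • w) := by
    refine ⟨_, _, by positivity, by positivity, ?_, rfl⟩
    field_simp
  have e : (α * b / (α * b + β * a)) • (a • u) + (β * a / (α * b + β * a)) • (b • w) =
      (a * b / (α * b + β * a)) • (α • u + β • w) := by
    simp only [smul_add, smul_smul]
    congr 2 <;> ring
  refine (Metric.infDist_le_dist_of_mem (x := 0) hp).trans ?_
  rw [e, dist_zero_left, norm_smul, Real.norm_of_nonneg (by positivity), dist_eq_norm]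
  have e2 : v - (v + α • u + β • w) = -(α • u + β • w) := by abel
  rw [e2, norm_neg]
  refine mul_le_of_le_one_left (norm_nonneg _) ?_
  rw [div_le_one hs]
  exact h3

end CornerDist

/-- Project onto `u + w`: since the edges have equal length, each has inner product ‖u + w‖²/2 with
`u + w`. -/
theorem le_cornerDist {E : Type*} [NormedAddCommGroup E] [InnerProductSpace ℝ E] {u w : E}
    (huw : ‖u‖ = ‖w‖) (a b : ℝ) :
    min a b * (‖u + w‖ / 2) ≤ cornerDist u w a b := by
  refine (Metric.le_infDist ⟨_, left_mem_segment ℝ _ _⟩).2 ?_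
  rintro _ ⟨s, t, hs, ht, hst, rfl⟩
  rw [dist_zero_left]
  rcases (norm_nonneg (u + w)).eq_or_lt with h0 | h0
  · rw [← h0]; simp
  have h1 := real_inner_le_norm (s • a • u + t • b • w) (u + w)
  have h2 : inner ℝ (s • a • u + t • b • w) (u + w) = (s * a + t * b) * (‖u + w‖ ^ 2 / 2) := by
    rw [norm_add_sq_real]
    simp only [inner_add_left, inner_add_right, real_inner_smul_left, real_inner_self_eq_norm_sq,
      real_inner_comm u w, huw]
    ring
  have h3 : min a b ≤ s * a + t * b := by
    calc min a b = s * min a b + t * min a b := by rw [← add_mul, hst, one_mul]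
      _ ≤ _ := by gcongr <;> simp
  rw [h2] at h1
  refine le_of_mul_le_mul_right ?_ h0
  calc min a b * (‖u + w‖ / 2) * ‖u + w‖ ≤ (s * a + t * b) * (‖u + w‖ / 2) * ‖u + w‖ := by gcongr
    _ = (s * a + t * b) * (‖u + w‖ ^ 2 / 2) := by ring
    _ ≤ _ := h1

/-- The Hausdorff distance between a polytope and a convex subset is attained at a vertex. -/
theorem hausdorffDist_convexHull_range_eq_iSup {ι E : Type*} [Finite ι] [Nonempty ι]
    [NormedAddCommGroup E] [NormedSpace ℝ E] (V : ι → E) {A : Set E} (hA : Convex ℝ A)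
    (hne : A.Nonempty) (hsub : A ⊆ convexHull ℝ (range V)) :
    Metric.hausdorffDist (convexHull ℝ (range V)) A = ⨆ k, Metric.infDist (V k) A := by
  have hb : Bornology.IsBounded (convexHull ℝ (range V)) :=
    isBounded_convexHull.2 (finite_range V).isBounded
  have hfin : Metric.hausdorffEDist (convexHull ℝ (range V)) A ≠ ⊤ :=
    Metric.hausdorffEDist_ne_top_of_nonempty_of_bounded
      (convexHull_nonempty_iff.2 (range_nonempty V)) hne hb (hb.subset hsub)
  have hbdd : BddAbove (range fun k => Metric.infDist (V k) A) := (finite_range _).bddAbove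
  have h0 : 0 ≤ ⨆ k, Metric.infDist (V k) A :=
    Real.iSup_nonneg fun k => Metric.infDist_nonneg
  refine le_antisymm ?_ ?_
  · refine Metric.hausdorffDist_le_of_infDist h0 ?_ ?_
    · have hmem : ∀ x, x ∈ Metric.cthickening (⨆ k, Metric.infDist (V k) A) A ↔
          Metric.infDist x A ≤ ⨆ k, Metric.infDist (V k) A := by
        intro x
        rw [Metric.mem_cthickening_iff, Metric.infDist,
          ENNReal.le_ofReal_iff_toReal_le (Metric.infEDist_ne_top hne) h0]
      -- A closed thickening of a convex set is convex, so it contains the hull as soon as it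
      -- contains the vertices.
      have : convexHull ℝ (range V) ⊆ Metric.cthickening (⨆ k, Metric.infDist (V k) A) A := by
        refine convexHull_min ?_ (hA.cthickening _)
        rintro _ ⟨k, rfl⟩
        exact (hmem _).2 (le_ciSup hbdd k)
      exact fun x hx => (hmem x).1 (this hx)
    · intro x hx
      rw [Metric.infDist_zero_of_mem (hsub hx)]
      exact h0
  · exact ciSup_le fun k => Metric.infDist_le_hausdorffDist_of_mem
      (subset_convexHull ℝ _ (mem_range_self k)) hfin

/-! ### Independent exponential variables and the mean of the largest corner distance. -/

theorem expMeasure_real_Ioi {r : ℝ} (hr : 0 < r) (t : ℝ) :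
    (expMeasure r).real (Ioi t) = Real.exp (-(r * max t 0)) := by
  have := isProbabilityMeasure_expMeasure hr
  rw [← compl_Iic, probReal_compl_eq_one_sub measurableSet_Iic, ← cdf_eq_real,
    cdf_expMeasure_eq hr]
  split_ifs with h
  · rw [max_eq_left h]; ring
  · rw [max_eq_right (by linarith)]; simp

/-- The law of a family of independent exponential random variables of rate `r`. -/
noncomputable def expPi (ι : Type*) [Fintype ι] (r : ℝ) : Measure (ι → ℝ) :=
  Measure.pi fun _ => expMeasure r

theorem isProbabilityMeasure_expPi (ι : Type*) [Fintype ι] {r : ℝ} (hr : 0 < r) :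
    IsProbabilityMeasure (expPi ι r) := by
  have := isProbabilityMeasure_expMeasure hr
  unfold expPi
  infer_instance

theorem expPi_real_survival {ι : Type*} [Fintype ι] {r : ℝ} (hr : 0 < r) (a : ι → ℝ) :
    (expPi ι r).real {x | ∀ i, a i < x i} = Real.exp (-(r * ∑ i, max (a i) 0)) := by
  have := isProbabilityMeasure_expMeasure hr
  have e : {x : ι → ℝ | ∀ i, a i < x i} = univ.pi fun i => Ioi (a i) := by
    ext x; simp
  rw [e, Measure.real, expPi, Measure.pi_pi, ENNReal.toReal_prod, Finset.mul_sum,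
    ← Finset.sum_neg_distrib, Real.exp_sum]
  exact Finset.prod_congr rfl fun i _ => expMeasure_real_Ioi hr _

theorem expPi_ae_nonneg (ι : Type*) [Fintype ι] {r : ℝ} (hr : 0 < r) :
    ∀ᵐ x ∂expPi ι r, ∀ i, 0 ≤ x i := by
  have := isProbabilityMeasure_expPi ι hr
  have h := expPi_real_survival hr (fun _ : ι => (0 : ℝ))
  simp only [max_self, Finset.sum_const_zero, mul_zero, neg_zero, Real.exp_zero] at h
  have hm : MeasurableSet {x : ι → ℝ | ∀ i, (0 : ℝ) < x i} := by
    simp only [ofPred_forall]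
    exact MeasurableSet.iInter fun i => measurableSet_lt measurable_const (measurable_pi_apply i)
  have h2 : ∀ᵐ x ∂expPi ι r, x ∈ {x : ι → ℝ | ∀ i, (0 : ℝ) < x i} := by
    refine (mem_ae_iff_prob_eq_one hm).2 ?_
    rw [← ENNReal.toReal_eq_one_iff]
    exact h
  filter_upwards [h2] with x hx i using (hx i).le

/-- The minima over the pairs are independent exponentials of rate 2r. Currying the product measure
separates the pairs, and the complementary event is a product set. -/
theorem expPi_real_exists_pair {κ : Type*} [Fintype κ] {r t : ℝ} (hr : 0 < r)
    (ht : 0 ≤ t) :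
    (expPi (κ × Bool) r).real {x | ∃ k, ∀ b, t < x (k, b)} =
      1 - (1 - Real.exp (-(2 * r) * t)) ^ Fintype.card κ := by
  have i0 := isProbabilityMeasure_expMeasure hr
  have i1 := isProbabilityMeasure_expPi (κ × Bool) hr
  have i2 := isProbabilityMeasure_expPi Bool hr
  have hA : MeasurableSet {y : Bool → ℝ | ∀ b, t < y b} := by
    simp only [ofPred_forall]
    exact MeasurableSet.iInter fun i => measurableSet_lt measurable_const (measurable_pi_apply i)
  have hB : MeasurableSet (univ.pi fun _ : κ => {y : Bool → ℝ | ∀ b, t < y b}ᶜ) :=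
    MeasurableSet.univ_pi fun _ => hA.compl
  have hmap := Measure.infinitePi_map_curry (fun (_ : κ) (_ : Bool) => expMeasure r)
  simp only [Measure.infinitePi_eq_pi] at hmap
  have e : {x : κ × Bool → ℝ | ∃ k, ∀ b, t < x (k, b)} =
      (MeasurableEquiv.curry κ Bool ℝ ⁻¹' univ.pi fun _ : κ => {y | ∀ b, t < y b}ᶜ)ᶜ := by
    ext x
    simp [MeasurableEquiv.curry]
  have hpair : (Measure.pi fun _ : Bool => expMeasure r).real {y : Bool → ℝ | ∀ b, t < y b}ᶜ =
      1 - Real.exp (-(2 * r) * t) := by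
    have := expPi_real_survival hr (fun _ : Bool => t)
    rw [max_eq_left ht] at this
    have i3 : IsProbabilityMeasure (Measure.pi fun _ : Bool => expMeasure r) := i2
    rw [probReal_compl_eq_one_sub hA, ← expPi, this]
    simp
    ring
  rw [e, probReal_compl_eq_one_sub (hB.preimage (MeasurableEquiv.measurable _)), expPi,
    ← map_measureReal_apply (MeasurableEquiv.measurable _) hB, hmap]
  have : (Measure.pi fun _ : κ => Measure.pi fun _ : Bool => expMeasure r).real
      (univ.pi fun _ : κ => {y : Bool → ℝ | ∀ b, t < y b}ᶜ) =
      (1 - Real.exp (-(2 * r) * t)) ^ Fintype.card κ := by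
    rw [Measure.real, Measure.pi_pi, ENNReal.toReal_prod, ← hpair]
    simp [Measure.real]
  rw [this]

theorem expPi_real_exists_pair_le {κ : Type*} [Fintype κ] {r t : ℝ} (hr : 0 < r)
    (ht : 0 ≤ t) :
    (expPi (κ × Bool) r).real {x | ∃ k, ∀ b, t < x (k, b)} ≤
      Fintype.card κ * Real.exp (-(2 * r) * t) := by
  rw [expPi_real_exists_pair hr ht]
  have h1 : Real.exp (-(2 * r) * t) ≤ 1 := Real.exp_le_one_iff.2 (by nlinarith)
  have := one_add_mul_le_pow (a := -Real.exp (-(2 * r) * t)) (by linarith) (Fintype.card κ)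
  rw [← sub_eq_add_neg] at this
  linarith

theorem continuous_iSup_of_fintype {κ X : Type*} [Fintype κ] [Nonempty κ] [TopologicalSpace X]
    {f : κ → X → ℝ} (hf : ∀ k, Continuous (f k)) : Continuous fun x => ⨆ k, f k x := by
  simp only [← Finset.sup'_univ_eq_ciSup]
  exact Continuous.finset_sup'_apply _ fun k _ => hf k

/-- The largest `cornerDist` over a family of corners. -/
noncomputable def maxCornerDist {κ E : Type*} [NormedAddCommGroup E] [NormedSpace ℝ E]
    (u w : κ → E) (z : κ × Bool → ℝ) : ℝ :=
  ⨆ k, cornerDist (u k) (w k) (z (k, false)) (z (k, true))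

section

variable {κ E : Type*} [NormedAddCommGroup E]

theorem maxCornerDist_nonneg [NormedSpace ℝ E] (u w : κ → E) (z : κ × Bool → ℝ) :
    0 ≤ maxCornerDist u w z :=
  Real.iSup_nonneg fun _ => cornerDist_nonneg _ _ _ _

theorem continuous_maxCornerDist [NormedSpace ℝ E] [Fintype κ] [Nonempty κ] (u w : κ → E) :
    Continuous (maxCornerDist u w) := by
  have h : ∀ k, Continuous fun z : κ × Bool → ℝ =>
      cornerDist (u k) (w k) (z (k, false)) (z (k, true)) := fun k =>
    (continuous_cornerDist (u k) (w k)).comp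
      (g := fun p : ℝ × ℝ => cornerDist (u k) (w k) p.1 p.2)
      (f := fun z : κ × Bool → ℝ => (z (k, false), z (k, true)))
      ((continuous_apply (k, false)).prodMk (continuous_apply (k, true)))
  exact continuous_iSup_of_fintype h

theorem maxCornerDist_smul [NormedSpace ℝ E] (u w : κ → E) {c : ℝ} (hc : 0 < c)
    (z : κ × Bool → ℝ) :
    maxCornerDist u w (fun i => c * z i) = c * maxCornerDist u w z := by
  simp only [maxCornerDist, cornerDist_mul _ _ hc, Real.mul_iSup_of_nonneg hc.le]

theorem exists_lt_of_lt_maxCornerDist [NormedSpace ℝ E] [Finite κ] [Nonempty κ]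
    {u w : κ → E} {D : ℝ}
    (hD : 0 < D) (huw : ∀ k, ‖u k + w k‖ = D) {z : κ × Bool → ℝ} (hz : ∀ i, 0 ≤ z i) {t : ℝ}
    (h : t < maxCornerDist u w z) : ∃ k, ∀ b, t / D < z (k, b) := by
  obtain ⟨k, hk⟩ := exists_lt_of_lt_ciSup h
  have := hk.trans_le (cornerDist_le (u k) (w k) (hz (k, false)) (hz (k, true)))
  rw [huw, ← div_lt_iff₀ hD, lt_min_iff] at this
  exact ⟨k, Bool.rec this.1 this.2⟩

/-- Truncation at (D/2r) log m, with m the number of corners, is where the tail bound m·exp(-2rt/D)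
reaches 1; the part beyond contributes D/(2r). -/
theorem integrable_and_integral_maxCornerDist_le [NormedSpace ℝ E] [Fintype κ] [Nonempty κ]
    {u w : κ → E}
    {D : ℝ} (hD : 0 < D) (huw : ∀ k, ‖u k + w k‖ = D) {r : ℝ} (hr : 0 < r) :
    Integrable (maxCornerDist u w) (expPi (κ × Bool) r) ∧
    ∫ z, maxCornerDist u w z ∂expPi (κ × Bool) r ≤
      D / (2 * r) * (Real.log (Fintype.card κ) + 1) := by
  have i1 := isProbabilityMeasure_expPi (κ × Bool) hr
  have hm : (1 : ℝ) ≤ Fintype.card κ := by exact_mod_cast Fintype.card_pos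
  have hlog := Real.log_nonneg hm
  have tail : ∀ t, 0 < t → (expPi (κ × Bool) r).real {x | t < maxCornerDist u w x} ≤
      Fintype.card κ * Real.exp (-(2 * r / D) * t) := by
    intro t ht
    have h3 : (expPi (κ × Bool) r).real {x | t < maxCornerDist u w x} ≤
        (expPi (κ × Bool) r).real {x | ∃ k, ∀ b, t / D < x (k, b)} := by
      refine ENNReal.toReal_mono (measure_ne_top _ _) (measure_mono_ae ?_)
      filter_upwards [expPi_ae_nonneg (κ × Bool) hr] with z hz hlt
      exact exists_lt_of_lt_maxCornerDist hD huw hz hlt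
    refine h3.trans ((expPi_real_exists_pair_le hr (by positivity)).trans (le_of_eq ?_))
    congr 2
    ring
  obtain ⟨h1, h2⟩ := integrable_and_integral_le_of_exp_tail (μ := expPi (κ × Bool) r)
    (continuous_maxCornerDist u w).measurable (maxCornerDist_nonneg u w)
    (C := Fintype.card κ) (c := 2 * r / D) (K := D / (2 * r) * Real.log (Fintype.card κ))
    (by positivity) (by positivity) (by positivity) tail
  refine ⟨h1, h2.trans ?_⟩
  have h3 : ∫ z, min (maxCornerDist u w z) (D / (2 * r) * Real.log (Fintype.card κ))
      ∂expPi (κ × Bool) r ≤ D / (2 * r) * Real.log (Fintype.card κ) := by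
    refine (integral_mono_of_nonneg (Eventually.of_forall fun z => ?_)
      (integrable_const (D / (2 * r) * Real.log (Fintype.card κ)))
      (Eventually.of_forall fun z => min_le_right _ _)).trans (le_of_eq (by simp))
    exact le_min (maxCornerDist_nonneg u w z) (by positivity)
  have h4 : (Fintype.card κ : ℝ) / (2 * r / D) *
      Real.exp (-(2 * r / D) * (D / (2 * r) * Real.log (Fintype.card κ))) = D / (2 * r) := by
    have : -(2 * r / D) * (D / (2 * r) * Real.log (Fintype.card κ)) =
        -Real.log (Fintype.card κ) := by field_simp
    rw [this, Real.exp_neg, Real.exp_log (by linarith)]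
    field_simp
  rw [h4]
  linarith

/-- At t = (log m)/(2r) a given corner has both coordinates above t with probability 1/m, so some
corner does with probability at least 1 - 1/e ≥ 1/2. Markov's inequality at level tD/2 concludes. -/
theorem le_integral_maxCornerDist [InnerProductSpace ℝ E] [Fintype κ] [Nonempty κ]
    {u w : κ → E} {D : ℝ}
    (hD : 0 < D) (huw : ∀ k, ‖u k + w k‖ = D) (heq : ∀ k, ‖u k‖ = ‖w k‖) {r : ℝ} (hr : 0 < r) :
    D / (8 * r) * Real.log (Fintype.card κ) ≤
      ∫ z, maxCornerDist u w z ∂expPi (κ × Bool) r := by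
  have i1 := isProbabilityMeasure_expPi (κ × Bool) hr
  have hm : (1 : ℝ) ≤ Fintype.card κ := by exact_mod_cast Fintype.card_pos
  have hlog := Real.log_nonneg hm
  have hint := (integrable_and_integral_maxCornerDist_le hD huw hr).1
  set t := Real.log (Fintype.card κ) / (2 * r) with ht
  have ht0 : 0 ≤ t := by positivity
  have h1 := mul_meas_ge_le_integral_of_nonneg
    (Eventually.of_forall (maxCornerDist_nonneg u w)) hint (t * (D / 2))
  have h2 : (expPi (κ × Bool) r).real {x | ∃ k, ∀ b, t < x (k, b)} ≤
      (expPi (κ × Bool) r).real {x | t * (D / 2) ≤ maxCornerDist u w x} := by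
    refine measureReal_mono ?_
    rintro z ⟨k, hk⟩
    have h3 : t ≤ min (z (k, false)) (z (k, true)) := le_min (hk false).le (hk true).le
    calc t * (D / 2) ≤ min (z (k, false)) (z (k, true)) * (‖u k + w k‖ / 2) := by
          rw [huw]; gcongr
      _ ≤ cornerDist (u k) (w k) (z (k, false)) (z (k, true)) := le_cornerDist (heq k) _ _
      _ ≤ maxCornerDist u w z :=
          le_ciSup (f := fun k => cornerDist (u k) (w k) (z (k, false)) (z (k, true)))
            (finite_range _).bddAbove k
  rw [expPi_real_exists_pair hr ht0] at h2
  have h4 : (1 - Real.exp (-(2 * r) * t)) ^ Fintype.card κ ≤ 1 / 2 := by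
    have e : Real.exp (-(2 * r) * t) = 1 / Fintype.card κ := by
      have : -(2 * r) * t = -Real.log (Fintype.card κ) := by rw [ht]; field_simp
      rw [this, Real.exp_neg, Real.exp_log (by linarith), one_div]
    rw [e]
    refine (Real.one_sub_div_pow_le_exp_neg hm).trans ?_
    rw [Real.exp_neg, one_div]
    gcongr
    linarith [Real.add_one_le_exp 1]
  have h5 : t * (D / 2) * (1 / 2) ≤ t * (D / 2) *
      (expPi (κ × Bool) r).real {x | t * (D / 2) ≤ maxCornerDist u w x} := by
    gcongr
    linarith
  refine le_trans (le_of_eq ?_) (h5.trans h1)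
  rw [ht]
  field_simp
  ring

end

/-! ### Equilateral polygons: the Hausdorff distance in terms of nearest sample points. -/

/-- `V` lists the vertices of a convex polygon in cyclic order, all sides having length `ℓ` and the
sum of the two edge vectors at any vertex having norm `D`. -/
structure IsEquilateralPolygon {M : ℕ} [NeZero M] (V : Fin M → Plane) (ℓ D : ℝ) : Prop where
  pos : 0 < ℓ
  pos' : 0 < D
  dist_eq : ∀ k, dist (V k) (V (k + 1)) = ℓ
  norm_eq : ∀ k, ‖(V (k - 1) - V k) + (V (k + 1) - V k)‖ = D
  frontier_eq : frontier (convexHull ℝ (range V)) = ⋃ k, segment ℝ (V k) (V (k + 1))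
  inter : ∀ j k, j ≠ k →
    (segment ℝ (V j) (V (j + 1)) ∩ segment ℝ (V k) (V (k + 1))).Subsingleton
  -- Seen from vertex `k`, every other vertex lies on or beyond the chord joining the two neighbours
  -- of `k`.
  cone : ∀ k j, j ≠ k → ∃ α β : ℝ, 0 ≤ α ∧ 0 ≤ β ∧ 1 ≤ α + β ∧
    V j = V k + α • (V (k - 1) - V k) + β • (V (k + 1) - V k)

section

variable {M : ℕ} [NeZero M]

/-- The other vertex of the side at vertex `i.1` in direction `i.2`. -/
def adjacentVertex (i : Fin M × Bool) : Fin M := bif i.2 then i.1 + 1 else i.1 - 1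

open Classical in
/-- The relative distance of `x` to vertex `i.1` along the side in direction `i.2`, with value `1`
for points outside this side. -/
noncomputable def sideCoord (V : Fin M → Plane) (ℓ : ℝ) (i : Fin M × Bool) (x : Plane) : ℝ :=
  -- The default 1 is the largest value on the side, so points elsewhere never lower the minimum.
  if x ∈ segment ℝ (V i.1) (V (adjacentVertex i)) then dist x (V i.1) / ℓ else 1

/-- The smallest `sideCoord` of a family of points. -/
noncomputable def minSideCoord (V : Fin M → Plane) (ℓ : ℝ) {n : ℕ} (x : Fin n → Plane)
    (i : Fin M × Bool) : ℝ :=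
  ⨅ j, sideCoord V ℓ i (x j)

variable {V : Fin M → Plane} {ℓ D : ℝ}

theorem IsEquilateralPolygon.dist_adjacent (h : IsEquilateralPolygon V ℓ D) (i : Fin M × Bool) :
    dist (V i.1) (V (adjacentVertex i)) = ℓ := by
  obtain ⟨k, _ | _⟩ := i
  · have := h.dist_eq (k - 1)
    rw [sub_add_cancel] at this
    rw [dist_comm]
    exact this
  · exact h.dist_eq k

theorem IsEquilateralPolygon.sideCoord_add_smul (h : IsEquilateralPolygon V ℓ D)
    (i : Fin M × Bool) {t : ℝ} (ht : t ∈ Icc (0 : ℝ) 1) :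
    sideCoord V ℓ i (V i.1 + t • (V (adjacentVertex i) - V i.1)) = t := by
  have hm : V i.1 + t • (V (adjacentVertex i) - V i.1) ∈
      segment ℝ (V i.1) (V (adjacentVertex i)) := by
    rw [segment_eq_image']
    exact ⟨t, ht, rfl⟩
  rw [sideCoord, if_pos hm, dist_eq_norm, add_sub_cancel_left, norm_smul,
    Real.norm_of_nonneg ht.1, ← dist_eq_norm, dist_comm, h.dist_adjacent]
  exact mul_div_cancel_right₀ _ h.pos.ne'

theorem IsEquilateralPolygon.sideCoord_mem_Icc (h : IsEquilateralPolygon V ℓ D)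
    (i : Fin M × Bool) (x : Plane) : sideCoord V ℓ i x ∈ Icc (0 : ℝ) 1 := by
  by_cases hx : x ∈ segment ℝ (V i.1) (V (adjacentVertex i))
  · rw [segment_eq_image'] at hx
    obtain ⟨t, ht, rfl⟩ := hx
    simpa only [h.sideCoord_add_smul i ht] using ht
  · simp [sideCoord, hx]

theorem IsEquilateralPolygon.eq_add_smul (h : IsEquilateralPolygon V ℓ D)
    (i : Fin M × Bool) {x : Plane} (hx : x ∈ segment ℝ (V i.1) (V (adjacentVertex i))) :
    x = V i.1 + sideCoord V ℓ i x • (V (adjacentVertex i) - V i.1) := by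
  rw [segment_eq_image'] at hx
  obtain ⟨t, ht, rfl⟩ := hx
  rw [h.sideCoord_add_smul i ht]

theorem measurable_sideCoord (V : Fin M → Plane) (ℓ : ℝ) (i : Fin M × Bool) :
    Measurable (sideCoord V ℓ i) := by
  unfold sideCoord
  refine Measurable.ite ?_ (by fun_prop) measurable_const
  have : IsCompact (segment ℝ (V i.1) (V (adjacentVertex i))) := by
    rw [segment_eq_image']
    exact isCompact_Icc.image (by fun_prop)
  exact this.measurableSet

theorem IsEquilateralPolygon.minSideCoord_mem_Icc (h : IsEquilateralPolygon V ℓ D) {n : ℕ}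
    [NeZero n] (x : Fin n → Plane) (i : Fin M × Bool) :
    minSideCoord V ℓ x i ∈ Icc (0 : ℝ) 1 := by
  obtain ⟨j, hj⟩ := exists_eq_ciInf_of_finite (f := fun j => sideCoord V ℓ i (x j))
  rw [minSideCoord, ← hj]
  exact h.sideCoord_mem_Icc i _

theorem lt_minSideCoord_iff {n : ℕ} [NeZero n] {x : Fin n → Plane} {i : Fin M × Bool} {s : ℝ} :
    s < minSideCoord V ℓ x i ↔ ∀ j, s < sideCoord V ℓ i (x j) := by
  obtain ⟨j, hj⟩ := exists_eq_ciInf_of_finite (f := fun j => sideCoord V ℓ i (x j))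
  refine ⟨fun h j => h.trans_le (ciInf_le (finite_range _).bddBelow j), fun h => ?_⟩
  rw [minSideCoord, ← hj]
  exact h j

/-- If every side contains a sample point other than its far vertex, the Hausdorff distance
between the polygon and the hull of the sample is determined by the sample points closest to the
vertices. -/
theorem IsEquilateralPolygon.hausdorffDist_eq_maxCornerDist (h : IsEquilateralPolygon V ℓ D)
    {n : ℕ} [NeZero n] {x : Fin n → Plane}
    (hx : ∀ j, x j ∈ frontier (convexHull ℝ (range V)))
    (hT : ∀ i, minSideCoord V ℓ x i < 1) :
    Metric.hausdorffDist (convexHull ℝ (range V)) (convexHull ℝ (range x)) =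
      maxCornerDist (fun k => V (k - 1) - V k) (fun k => V (k + 1) - V k)
        (minSideCoord V ℓ x) := by
  have hcl : frontier (convexHull ℝ (range V)) ⊆ convexHull ℝ (range V) :=
    ((finite_range V).isCompact_convexHull ℝ).isClosed.frontier_subset
  rw [hausdorffDist_convexHull_range_eq_iSup V (convex_convexHull ℝ _)
    (convexHull_nonempty_iff.2 (range_nonempty x))
    (convexHull_min (range_subset_iff.2 fun j => hcl (hx j)) (convex_convexHull ℝ _))]
  unfold maxCornerDist
  congr 1
  ext k
  -- A minimum below 1 cannot be the default value, so it is attained at a sample point on the side.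
  have hmem : ∀ i : Fin M × Bool,
      V i.1 + minSideCoord V ℓ x i • (V (adjacentVertex i) - V i.1) ∈ range x := by
    intro i
    obtain ⟨j, hj⟩ := exists_eq_ciInf_of_finite (f := fun j => sideCoord V ℓ i (x j))
    have hj : sideCoord V ℓ i (x j) = minSideCoord V ℓ x i := hj
    have hlt := hT i
    rw [← hj] at hlt ⊢
    have hs : x j ∈ segment ℝ (V i.1) (V (adjacentVertex i)) := by
      by_contra hs
      simp [sideCoord, hs] at hlt
    exact ⟨j, h.eq_add_smul i hs⟩
  have hle : ∀ i j, minSideCoord V ℓ x i ≤ sideCoord V ℓ i (x j) := fun i j =>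
    ciInf_le (finite_range _).bddBelow j
  have h0 := fun i => h.minSideCoord_mem_Icc x i
  refine infDist_convexHull_eq_cornerDist (h0 _).1 (h0 _).1 (hmem (k, false)) (hmem (k, true)) ?_
  rintro _ ⟨j, rfl⟩
  obtain ⟨a0, a1⟩ := h0 (k, false)
  obtain ⟨b0, b1⟩ := h0 (k, true)
  have ha := hle (k, false) j
  have hb := hle (k, true) j
  set a := minSideCoord V ℓ x (k, false)
  set b := minSideCoord V ℓ x (k, true)
  have hxj := hx j
  rw [h.frontier_eq, mem_iUnion] at hxj
  obtain ⟨m, hm⟩ := hxj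
  by_cases hmk : m = k
  · subst hmk
    refine ⟨0, sideCoord V ℓ (m, true) (x j), le_rfl, (h.sideCoord_mem_Icc _ _).1, ?_, ?_⟩
    · nlinarith
    · rw [zero_smul, add_zero]
      exact h.eq_add_smul (m, true) hm
  by_cases hmk' : m + 1 = k
  · subst hmk'
    refine ⟨sideCoord V ℓ (m + 1, false) (x j), 0, (h.sideCoord_mem_Icc _ _).1, le_rfl, ?_, ?_⟩
    · nlinarith
    · rw [zero_smul, add_zero]
      have := h.eq_add_smul (m + 1, false) (x := x j)
      simp only [adjacentVertex, cond_false, add_sub_cancel_right] at this ⊢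
      exact this (by rwa [segment_symm])
  -- Here the side avoids vertex `k`, so `cone` applies to both endpoints and its inequality passes
  -- to the points between them. Since a, b ≤ 1, coefficients with sum at least 1 satisfy the
  -- required ab ≤ αb + βa.
  obtain ⟨α, β, h1, h2, h3, h4⟩ := h.cone k m hmk
  obtain ⟨α', β', h1', h2', h3', h4'⟩ := h.cone k (m + 1) hmk'
  obtain ⟨s, t, hs, ht, hst, he⟩ := hm
  refine ⟨s * α + t * α', s * β + t * β', by positivity, by positivity, ?_, ?_⟩
  · have e1 : 1 ≤ s * (α + β) + t * (α' + β') := by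
      calc 1 = s * 1 + t * 1 := by linarith
        _ ≤ _ := by gcongr
    have e2 : 0 ≤ s * α + t * α' := by positivity
    have e3 : 0 ≤ s * β + t * β' := by positivity
    have e4 : a * b ≤ a * b * (s * (α + β) + t * (α' + β')) :=
      le_mul_of_one_le_right (by positivity) e1
    have e5 : a * b * (s * α + t * α') ≤ b * (s * α + t * α') := by
      refine mul_le_mul_of_nonneg_right ?_ e2
      nlinarith
    have e6 : a * b * (s * β + t * β') ≤ a * (s * β + t * β') := by
      refine mul_le_mul_of_nonneg_right ?_ e3
      nlinarith
    linarith
  · rw [← he, h4, h4']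
    have : V k = s • V k + t • V k := by rw [← add_smul, hst, one_smul]
    nth_rewrite 7 [this]
    simp only [smul_add, add_smul, mul_smul]
    abel

end

/-! ### The joint law of the nearest-point coordinates. -/

theorem IsUniformBoundarySample.ae_mem_frontier {Ω : Type*} [MeasurableSpace Ω] {P : Measure Ω}
    {Q : Set Plane} {n : ℕ} {X : Fin n → Ω → Plane} (hX : IsUniformBoundarySample P Q X) :
    ∀ᵐ ω ∂P, ∀ j, X j ω ∈ frontier Q := by
  refine ae_all_iff.2 fun j => ae_of_ae_map (hX.measurable j).aemeasurable ?_
  rw [hX.uniform j]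
  exact ae_cond_mem isClosed_frontier.measurableSet

namespace IsEquilateralPolygon

variable {M : ℕ} [NeZero M] {V : Fin M → Plane} {ℓ D : ℝ}

theorem sideCoord_lineMap_true (h : IsEquilateralPolygon V ℓ D) (k : Fin M) {t : ℝ}
    (ht : t ∈ Icc (0 : ℝ) 1) :
    sideCoord V ℓ (k, true) (AffineMap.lineMap (V k) (V (k + 1)) t) = t := by
  have := h.sideCoord_add_smul (k, true) ht
  rw [AffineMap.lineMap_apply_module']
  rw [add_comm] at this
  exact this

theorem sideCoord_lineMap_false (h : IsEquilateralPolygon V ℓ D) (k : Fin M) {t : ℝ}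
    (ht : t ∈ Icc (0 : ℝ) 1) :
    sideCoord V ℓ (k + 1, false) (AffineMap.lineMap (V k) (V (k + 1)) t) = 1 - t := by
  have := h.sideCoord_add_smul (k + 1, false) (t := 1 - t) ⟨by linarith [ht.2], by linarith [ht.1]⟩
  rw [← AffineMap.lineMap_apply_one_sub, AffineMap.lineMap_apply_module']
  simp only [adjacentVertex, cond_false, add_sub_cancel_right] at this ⊢
  rw [add_comm ((1 - t) • _)]
  exact this

theorem lineMap_mem_segment (V : Fin M → Plane) (k : Fin M) {t : ℝ} (ht : t ∈ Icc (0 : ℝ) 1) :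
    AffineMap.lineMap (V k) (V (k + 1)) t ∈ segment ℝ (V k) (V (k + 1)) := by
  rw [segment_eq_image_lineMap]
  exact ⟨t, ht, rfl⟩

/-- On side `k` only its two own coordinates constrain anything: they cut off one piece at each end.
All other coordinates take the default 1 > 1/2, except at the finitely many points shared with other
sides. -/
theorem volume_lineMap_preimage (h : IsEquilateralPolygon V ℓ D) {s : Fin M × Bool → ℝ}
    (hs : ∀ i, s i ≤ 1 / 2) (k : Fin M) :
    volume {t ∈ Icc (0 : ℝ) 1 |
        ∀ i, s i < sideCoord V ℓ i (AffineMap.lineMap (V k) (V (k + 1)) t)} =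
      ENNReal.ofReal (1 - max (s (k, true)) 0 - max (s (k + 1, false)) 0) := by
  set a := max (s (k, true)) 0 with ha
  set b := max (s (k + 1, false)) 0 with hb
  have hne : V k ≠ V (k + 1) := by
    intro e
    have := h.dist_eq k
    rw [e, dist_self] at this
    exact h.pos.ne this
  have hinj := AffineMap.lineMap_injective ℝ hne
  set N : Set ℝ := ⋃ j ∈ {j : Fin M | j ≠ k}, {t ∈ Icc (0 : ℝ) 1 |
    AffineMap.lineMap (V k) (V (k + 1)) t ∈ segment ℝ (V j) (V (j + 1))} with hN
  have hNf : N.Finite := by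
    refine (toFinite _).biUnion fun j hj => Subsingleton.finite ?_
    rintro t ⟨ht, ht'⟩ t' ⟨ht2, ht2'⟩
    exact hinj (h.inter j k hj ⟨ht', lineMap_mem_segment V k ht⟩
      ⟨ht2', lineMap_mem_segment V k ht2⟩)
  refine le_antisymm ?_ ?_
  · have hsub : {t ∈ Icc (0 : ℝ) 1 |
        ∀ i, s i < sideCoord V ℓ i (AffineMap.lineMap (V k) (V (k + 1)) t)} ⊆ Icc a (1 - b) := by
      rintro t ⟨ht, hi⟩
      have h1 := hi (k, true)
      have h2 := hi (k + 1, false)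
      rw [h.sideCoord_lineMap_true k ht] at h1
      rw [h.sideCoord_lineMap_false k ht] at h2
      refine ⟨max_le h1.le ht.1, ?_⟩
      have : b ≤ 1 - t := max_le h2.le (by linarith [ht.2])
      linarith
    refine (measure_mono hsub).trans (le_of_eq ?_)
    rw [Real.volume_Icc]
    congr 1
    ring
  · have hsub : Ioo a (1 - b) \ N ⊆ {t ∈ Icc (0 : ℝ) 1 |
        ∀ i, s i < sideCoord V ℓ i (AffineMap.lineMap (V k) (V (k + 1)) t)} := by
      rintro t ⟨ht, htN⟩
      have ha0 : 0 ≤ a := le_max_right _ _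
      have hb0 : 0 ≤ b := le_max_right _ _
      have ht1 : t ∈ Icc (0 : ℝ) 1 := ⟨by linarith [ht.1], by linarith [ht.2]⟩
      refine ⟨ht1, ?_⟩
      have hoff : ∀ j, j ≠ k →
          AffineMap.lineMap (V k) (V (k + 1)) t ∉ segment ℝ (V j) (V (j + 1)) := by
        intro j hj hmem
        exact htN (mem_biUnion (x := j) hj ⟨ht1, hmem⟩)
      rintro ⟨j, _ | _⟩
      · by_cases hj : j = k + 1
        · subst hj
          rw [h.sideCoord_lineMap_false k ht1]
          have : s (k + 1, false) ≤ b := le_max_left _ _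
          linarith [ht.2]
        · have hj' : j - 1 ≠ k := fun e => hj (by rw [← e, sub_add_cancel])
          have := hoff _ hj'
          rw [sub_add_cancel, segment_symm] at this
          rw [sideCoord, if_neg (by exact this)]
          linarith [hs (j, false)]
      · by_cases hj : j = k
        · subst hj
          rw [h.sideCoord_lineMap_true j ht1]
          have : s (j, true) ≤ a := le_max_left _ _
          linarith [ht.1]
        · rw [sideCoord, if_neg (by exact hoff j hj)]
          linarith [hs (j, true)]
    refine le_trans (le_of_eq ?_) (measure_mono hsub)
    rw [measure_sdiff_null (hNf.measure_zero _), Real.volume_Ioo]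
    congr 1
    ring

theorem measurableSet_sideCoord (V : Fin M → Plane) (ℓ : ℝ) (s : Fin M × Bool → ℝ) :
    MeasurableSet {x | ∀ i, s i < sideCoord V ℓ i x} := by
  simp only [ofPred_forall]
  exact MeasurableSet.iInter fun i => measurableSet_lt measurable_const (measurable_sideCoord V ℓ i)

/-- The length of the part of the boundary at prescribed distances from the vertices. -/
theorem hausdorffMeasure_frontier_inter (h : IsEquilateralPolygon V ℓ D) {s : Fin M × Bool → ℝ}
    (hs : ∀ i, s i ≤ 1 / 2) :
    (Measure.hausdorffMeasure 1 : Measure Plane)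
      (frontier (convexHull ℝ (range V)) ∩ {x | ∀ i, s i < sideCoord V ℓ i x}) =
      ENNReal.ofReal (ℓ * (M - ∑ i, max (s i) 0)) := by
  have := Measure.nullSingletonClass_hausdorff Plane (d := 1) one_pos
  have hseg : ∀ k, MeasurableSet (segment ℝ (V k) (V (k + 1))) := fun k => by
    rw [segment_eq_image']
    exact (isCompact_Icc.image (by fun_prop)).measurableSet
  have hb : ∀ i, max (s i) 0 ≤ 1 / 2 := fun i => max_le (hs i) (by norm_num)
  have hk : ∀ k, (Measure.hausdorffMeasure 1 : Measure Plane)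
      (segment ℝ (V k) (V (k + 1)) ∩ {x | ∀ i, s i < sideCoord V ℓ i x}) =
      ENNReal.ofReal (ℓ * (1 - max (s (k, true)) 0 - max (s (k + 1, false)) 0)) := by
    intro k
    have e : segment ℝ (V k) (V (k + 1)) ∩ {x | ∀ i, s i < sideCoord V ℓ i x} =
        AffineMap.lineMap (V k) (V (k + 1)) '' {t ∈ Icc (0 : ℝ) 1 |
          ∀ i, s i < sideCoord V ℓ i (AffineMap.lineMap (V k) (V (k + 1)) t)} := by
      rw [segment_eq_image_lineMap, ← image_inter_preimage]
      rfl
    rw [e, hausdorffMeasure_lineMap_image, hausdorffMeasure_real, h.volume_lineMap_preimage hs,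
      ENNReal.ofReal_mul h.pos.le, ENNReal.smul_def, smul_eq_mul, ← edist_nndist, edist_dist,
      h.dist_eq]
  rw [h.frontier_eq, iUnion_inter, measure_iUnion₀, tsum_fintype]
  · simp only [hk]
    rw [← ENNReal.ofReal_sum_of_nonneg]
    · congr 1
      rw [← Finset.mul_sum, Finset.sum_sub_distrib, Finset.sum_sub_distrib,
        Fintype.sum_prod_type, Finset.sum_const, Finset.card_univ, Fintype.card_fin, nsmul_one]
      simp only [Fintype.sum_bool, Finset.sum_add_distrib]
      have := Equiv.sum_comp (Equiv.addRight (1 : Fin M)) fun k => max (s (k, false)) 0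
      simp only [Equiv.coe_addRight] at this
      rw [this]
      ring
    · intro k _
      have := hb (k, true)
      have := hb (k + 1, false)
      exact mul_nonneg h.pos.le (by linarith)
  · intro j k hjk
    refine measure_mono_null ?_ ((h.inter j k hjk).measure_zero _)
    rintro x ⟨⟨h1, -⟩, ⟨h2, -⟩⟩
    exact ⟨h1, h2⟩
  · exact fun k => ((hseg k).inter (measurableSet_sideCoord V ℓ s)).nullMeasurableSet

theorem hausdorffMeasure_frontier (h : IsEquilateralPolygon V ℓ D) :
    (Measure.hausdorffMeasure 1 : Measure Plane) (frontier (convexHull ℝ (range V))) =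
      ENNReal.ofReal (ℓ * M) := by
  -- Coordinates are nonnegative, so the level -1 imposes no condition.
  have := h.hausdorffMeasure_frontier_inter (s := fun _ => -1) (fun i => by norm_num)
  have e : {x | ∀ i, (-1 : ℝ) < sideCoord V ℓ i x} = univ :=
    eq_univ_of_forall fun x i => by linarith [(h.sideCoord_mem_Icc i x).1]
  rw [e, inter_univ] at this
  rw [this]
  norm_num

theorem boundaryLength_eq (h : IsEquilateralPolygon V ℓ D) :
    boundaryLength (convexHull ℝ (range V)) = ℓ * M := by
  rw [boundaryLength, Measure.real, h.hausdorffMeasure_frontier,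
    ENNReal.toReal_ofReal (mul_nonneg h.pos.le M.cast_nonneg)]

section Sample

variable {Ω : Type*} [MeasurableSpace Ω] {P : Measure Ω} {n : ℕ} {X : Fin n → Ω → Plane}

theorem measureReal_sample (h : IsEquilateralPolygon V ℓ D)
    (hX : IsUniformBoundarySample P (convexHull ℝ (range V)) X) {s : Fin M × Bool → ℝ}
    (hs : ∀ i, s i ≤ 1 / 2) (j : Fin n) :
    P.real (X j ⁻¹' {x | ∀ i, s i < sideCoord V ℓ i x}) = 1 - (∑ i, max (s i) 0) / M := by
  have hM : (0 : ℝ) < M := by exact_mod_cast NeZero.pos M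
  have hpos : 0 < ℓ * M := mul_pos h.pos hM
  have hne : (Measure.hausdorffMeasure 1 : Measure Plane)
      (frontier (convexHull ℝ (range V))) ≠ 0 := by
    rw [h.hausdorffMeasure_frontier]
    simpa using hpos
  have hnt : (Measure.hausdorffMeasure 1 : Measure Plane)
      (frontier (convexHull ℝ (range V))) ≠ ⊤ := by
    rw [h.hausdorffMeasure_frontier]
    exact ENNReal.ofReal_ne_top
  have hle : ∑ i, max (s i) 0 ≤ M := by
    refine (Finset.sum_le_sum fun i _ => max_le (hs i) (by norm_num : (0 : ℝ) ≤ 1 / 2)).trans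
      (le_of_eq ?_)
    simp
  rw [Measure.real, (hX.uniform j).measure_preimage hne hnt (measurableSet_sideCoord V ℓ s),
    h.hausdorffMeasure_frontier_inter hs, h.hausdorffMeasure_frontier, ENNReal.toReal_div,
    ENNReal.toReal_ofReal hpos.le, ENNReal.toReal_ofReal (mul_nonneg h.pos.le (by linarith))]
  have := h.pos
  field_simp

theorem measurable_minSideCoord (hX : ∀ j, Measurable (X j)) (i : Fin M × Bool) :
    Measurable fun ω => minSideCoord V ℓ (fun j => X j ω) i :=
  Measurable.iInf fun j => (measurable_sideCoord V ℓ i).comp (hX j)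

/-- The joint survival function of the distances from the vertices to the closest points of a
sample. -/
theorem measureReal_minSideCoord (h : IsEquilateralPolygon V ℓ D) [NeZero n]
    (hX : IsUniformBoundarySample P (convexHull ℝ (range V)) X) {s : Fin M × Bool → ℝ}
    (hs : ∀ i, s i ≤ 1 / 2) :
    P.real {ω | ∀ i, s i < minSideCoord V ℓ (fun j => X j ω) i} =
      (1 - (∑ i, max (s i) 0) / M) ^ n := by
  have e : {ω | ∀ i, s i < minSideCoord V ℓ (fun j => X j ω) i} =
      ⋂ j ∈ (Finset.univ : Finset (Fin n)), X j ⁻¹' {x | ∀ i, s i < sideCoord V ℓ i x} := by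
    ext ω
    simp only [lt_minSideCoord_iff, mem_ofPred_eq, Finset.mem_univ, iInter_true, mem_iInter,
      mem_preimage]
    exact forall_comm
  rw [e, Measure.real, hX.indep.measure_inter_preimage_eq_mul _
    fun j _ => measurableSet_sideCoord V ℓ s, ENNReal.toReal_prod]
  refine (Finset.prod_congr rfl fun j _ => h.measureReal_sample hX hs j).trans ?_
  simp

end Sample

end IsEquilateralPolygon

theorem tendsto_natCast_mul_exp_neg {c : ℝ} (hc : 0 < c) :
    Tendsto (fun n : ℕ => (n : ℝ) * Real.exp (-(c * n))) atTop (𝓝 0) := by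
  have h := ((Real.tendsto_pow_mul_exp_neg_atTop_nhds_zero 1).comp
    (tendsto_natCast_atTop_atTop.const_mul_atTop hc)).const_mul (1 / c)
  rw [mul_zero] at h
  refine h.congr fun n => ?_
  simp only [Function.comp_apply, pow_one]
  field_simp

/-! ### Reduction to nearest points and the limit of the rescaled expectation. -/

namespace IsEquilateralPolygon

variable {M : ℕ} [NeZero M] {V : Fin M → Plane} {ℓ D : ℝ}

section Sample

variable {Ω : Type*} [MeasurableSpace Ω] {P : Measure Ω} {n : ℕ} {X : Fin n → Ω → Plane}

theorem hullDist_ae_eq_iSup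
    (hX : IsUniformBoundarySample P (convexHull ℝ (range V)) X) [NeZero n] :
    ∀ᵐ ω ∂P, hullDist (convexHull ℝ (range V)) X ω =
      ⨆ k, Metric.infDist (V k) (convexHull ℝ (range fun j => X j ω)) := by
  have hcl : frontier (convexHull ℝ (range V)) ⊆ convexHull ℝ (range V) :=
    ((finite_range V).isCompact_convexHull ℝ).isClosed.frontier_subset
  filter_upwards [hX.ae_mem_frontier] with ω hω
  exact hausdorffDist_convexHull_range_eq_iSup V (convex_convexHull ℝ _)
    (convexHull_nonempty_iff.2 (range_nonempty _))
    (convexHull_min (range_subset_iff.2 fun j => hcl (hω j)) (convex_convexHull ℝ _))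

theorem hullDist_ae_le_diam
    (hX : IsUniformBoundarySample P (convexHull ℝ (range V)) X) [NeZero n] :
    ∀ᵐ ω ∂P, hullDist (convexHull ℝ (range V)) X ω ≤ Metric.diam (convexHull ℝ (range V)) := by
  have hcl : frontier (convexHull ℝ (range V)) ⊆ convexHull ℝ (range V) :=
    ((finite_range V).isCompact_convexHull ℝ).isClosed.frontier_subset
  filter_upwards [hX.ae_mem_frontier, hullDist_ae_eq_iSup hX] with ω hω he
  rw [he]
  refine ciSup_le fun k => ?_
  refine (Metric.infDist_le_dist_of_mem
    (subset_convexHull ℝ _ (mem_range_self (0 : Fin n)))).trans ?_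
  exact Metric.dist_le_diam_of_mem (isBounded_convexHull.2 (finite_range V).isBounded)
    (subset_convexHull ℝ _ (mem_range_self k)) (hcl (hω 0))

variable [IsProbabilityMeasure P]

theorem measureReal_lt_mul_minSideCoord_le (h : IsEquilateralPolygon V ℓ D) [NeZero n]
    (hX : IsUniformBoundarySample P (convexHull ℝ (range V)) X) (i : Fin M × Bool) {t : ℝ}
    (ht : 0 < t) :
    P.real {ω | t < n * minSideCoord V ℓ (fun j => X j ω) i} ≤ Real.exp (-(t / (2 * M))) := by
  classical
  have hM : (0 : ℝ) < M := by exact_mod_cast NeZero.pos M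
  have hn : (0 : ℝ) < n := by exact_mod_cast NeZero.pos n
  have hM1 : (1 : ℝ) ≤ M := by exact_mod_cast NeZero.one_le
  rcases le_or_gt (n : ℝ) t with htn | htn
  · have : {ω | t < n * minSideCoord V ℓ (fun j => X j ω) i} = ∅ := by
      refine eq_empty_of_forall_notMem fun ω hω => ?_
      have h1 := (h.minSideCoord_mem_Icc (fun j => X j ω) i).2
      have h2 : t < n * minSideCoord V ℓ (fun j => X j ω) i := hω
      nlinarith
    rw [this]
    simp [Real.exp_nonneg]
  -- The exact survival formula covers levels up to 1/2, while t/n can be close to 1. Halving the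
  -- level costs a factor 2 in the exponent; level -1 frees the other coordinates.
  have hs : t / (2 * n) ≤ 1 / 2 := by
    rw [div_le_div_iff₀ (by positivity) two_pos]
    linarith
  have hsub : {ω | t < n * minSideCoord V ℓ (fun j => X j ω) i} ⊆
      {ω | ∀ i', (if i' = i then t / (2 * n) else -1) < minSideCoord V ℓ (fun j => X j ω) i'} := by
    intro ω hω i'
    have h2 : t < n * minSideCoord V ℓ (fun j => X j ω) i := hω
    split_ifs with hi
    · rw [hi, div_lt_iff₀ (by positivity)]
      linarith
    · linarith [(h.minSideCoord_mem_Icc (fun j => X j ω) i').1]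
  refine (measureReal_mono hsub).trans ?_
  rw [h.measureReal_minSideCoord hX]
  · have e : ∑ i', max (if i' = i then t / (2 * n) else -1) 0 = t / (2 * n) := by
      rw [Finset.sum_eq_single i]
      · rw [if_pos rfl, max_eq_left (by positivity)]
      · intro j _ hj
        simp [hj]
      · simp
    rw [e]
    have e2 : t / (2 * n) / M = t / (2 * M) / n := by field_simp
    rw [e2]
    refine Real.one_sub_div_pow_le_exp_neg ?_
    rw [div_le_iff₀ (by positivity)]
    nlinarith
  · intro i'
    split_ifs
    · exact hs
    · norm_num

theorem integrable_hullDist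
    (hX : IsUniformBoundarySample P (convexHull ℝ (range V)) X) :
    Integrable (hullDist (convexHull ℝ (range V)) X) P := by
  rcases Nat.eq_zero_or_pos n with rfl | hn
  -- Without sample points the hull is empty and `Metric.hausdorffDist` takes its default value 0.
  · have : hullDist (convexHull ℝ (range V)) X = fun _ => 0 := by
      ext ω
      simp [hullDist]
    rw [this]
    exact integrable_zero _ _ _
  have : NeZero n := ⟨hn.ne'⟩
  refine Integrable.of_bound ?_ (Metric.diam (convexHull ℝ (range V))) ?_
  · have hc : Continuous fun x : Fin n → Plane =>
        ⨆ k, Metric.infDist (V k) (convexHull ℝ (range x)) :=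
      continuous_iSup_of_fintype fun k => continuous_infDist_convexHull_range (V k)
    exact AEStronglyMeasurable.congr
      (hc.measurable.comp (measurable_pi_lambda _ hX.measurable)).aestronglyMeasurable
      ((hullDist_ae_eq_iSup hX).mono fun ω hω => hω.symm)
  · filter_upwards [hullDist_ae_le_diam hX] with ω hω
    rw [Real.norm_of_nonneg (by exact Metric.hausdorffDist_nonneg)]
    exact hω

/-- Up to an exponentially small error, the expected Hausdorff distance only depends on the sample
points closest to the vertices. -/
theorem abs_integral_hullDist_sub_le (h : IsEquilateralPolygon V ℓ D) [NeZero n]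
    (hX : IsUniformBoundarySample P (convexHull ℝ (range V)) X) :
    |n * ∫ ω, hullDist (convexHull ℝ (range V)) X ω ∂P - ∫ ω, maxCornerDist
      (fun k => V (k - 1) - V k) (fun k => V (k + 1) - V k)
      (fun i => n * minSideCoord V ℓ (fun j => X j ω) i) ∂P| ≤
      (Metric.diam (convexHull ℝ (range V)) + D) * (2 * M) *
        (n * Real.exp (-(1 / (4 * M) * n))) := by
  have hn : (0 : ℝ) < n := by exact_mod_cast NeZero.pos n
  have hM : (0 : ℝ) < M := by exact_mod_cast NeZero.pos M
  set F := maxCornerDist (fun k => V (k - 1) - V k) (fun k => V (k + 1) - V k) with hF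
  set T := fun ω => minSideCoord V ℓ (fun j => X j ω) with hT
  set B := Metric.diam (convexHull ℝ (range V)) + D with hB
  have hB0 : 0 ≤ B := add_nonneg Metric.diam_nonneg h.pos'.le
  have hTm : ∀ i, Measurable fun ω => T ω i := fun i => measurable_minSideCoord hX.measurable i
  have hFT : Measurable fun ω => F (T ω) :=
    (continuous_maxCornerDist _ _).measurable.comp (measurable_pi_lambda _ hTm)
  have hFle : ∀ ω, F (T ω) ≤ D := by
    intro ω
    refine ciSup_le fun k => ?_
    have h0 := fun i => h.minSideCoord_mem_Icc (fun j => X j ω) i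
    refine (cornerDist_le _ _ (h0 _).1 (h0 _).1).trans ?_
    rw [h.norm_eq]
    exact mul_le_of_le_one_left h.pos'.le (min_le_of_left_le (h0 _).2)
  have hFi : Integrable (fun ω => F (T ω)) P :=
    Integrable.of_bound hFT.aestronglyMeasurable D (Eventually.of_forall fun ω => by
      rw [Real.norm_of_nonneg (maxCornerDist_nonneg _ _ _)]
      exact hFle ω)
  have hHi := integrable_hullDist hX
  -- The bad event: some side has no sample point except possibly its far vertex. Off it the two
  -- quantities agree almost surely; on it their difference is at most `B`.
  set G : Set Ω := ⋃ i, {ω | 1 ≤ T ω i} with hG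
  have hGm : MeasurableSet G :=
    MeasurableSet.iUnion fun i => measurableSet_le measurable_const (hTm i)
  have hGP : P.real G ≤ 2 * M * Real.exp (-(1 / (4 * M) * n)) := by
    refine (measureReal_iUnion_fintype_le _).trans ?_
    have : ∀ i, P.real {ω | 1 ≤ T ω i} ≤ Real.exp (-(1 / (4 * M) * n)) := by
      intro i
      have h1 := h.measureReal_lt_mul_minSideCoord_le hX i (t := n / 2) (by positivity)
      refine (measureReal_mono ?_).trans (h1.trans (le_of_eq ?_))
      · intro ω hω
        have h2 : 1 ≤ T ω i := hω
        change (n : ℝ) / 2 < n * T ω i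
        nlinarith
      · congr 1
        field_simp
        ring
    refine (Finset.sum_le_sum fun i _ => this i).trans (le_of_eq ?_)
    simp
    ring
  have hsmul : ∀ ω, F (fun i => n * T ω i) = n * F (T ω) := fun ω => maxCornerDist_smul _ _ hn _
  have hae : ∀ᵐ ω ∂P, |hullDist (convexHull ℝ (range V)) X ω - F (T ω)| ≤
      G.indicator (fun _ => B) ω := by
    filter_upwards [hX.ae_mem_frontier, hullDist_ae_le_diam hX] with ω h1 h2
    by_cases hω : ω ∈ G
    · rw [indicator_of_mem hω, abs_le]
      have h3 : 0 ≤ hullDist (convexHull ℝ (range V)) X ω := Metric.hausdorffDist_nonneg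
      have h4 : 0 ≤ F (T ω) := maxCornerDist_nonneg _ _ _
      have h5 : 0 ≤ Metric.diam (convexHull ℝ (range V)) := Metric.diam_nonneg
      have h6 := hFle ω
      have h7 := h.pos'
      constructor <;> linarith
    · rw [indicator_of_notMem hω]
      have h3 : ∀ i, T ω i < 1 := by
        intro i
        by_contra! hi
        exact hω (mem_iUnion.2 ⟨i, hi⟩)
      rw [hullDist, h.hausdorffDist_eq_maxCornerDist h1 h3, sub_self, abs_zero]
  change |_ - ∫ ω, F (fun i => n * T ω i) ∂P| ≤ _
  simp only [hsmul]
  rw [integral_const_mul, ← mul_sub, ← integral_sub hHi hFi, abs_mul, abs_of_pos hn]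
  have hint : |∫ ω, (hullDist (convexHull ℝ (range V)) X ω - F (T ω)) ∂P| ≤ B * P.real G := by
    refine (abs_integral_le_integral_abs).trans ?_
    refine (integral_mono_ae (hHi.sub hFi).abs ((integrable_const B).indicator hGm) hae).trans
      (le_of_eq ?_)
    rw [integral_indicator_const _ hGm, smul_eq_mul, mul_comm]
  calc _ ≤ n * (B * (2 * M * Real.exp (-(1 / (4 * M) * n)))) := by
        gcongr
        exact hint.trans (by gcongr)
    _ = _ := by ring

end Sample

/-- The limit of the rescaled expected Hausdorff distance. -/
theorem tendsto_integral_hullDist (h : IsEquilateralPolygon V ℓ D) {Ω : ℕ → Type*}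
    [∀ n, MeasurableSpace (Ω n)] {P : ∀ n, Measure (Ω n)} [∀ n, IsProbabilityMeasure (P n)]
    {X : ∀ n, Fin n → Ω n → Plane}
    (hX : ∀ n, IsUniformBoundarySample (P n) (convexHull ℝ (range V)) (X n)) :
    Tendsto (fun n : ℕ => (n : ℝ) * ∫ ω, hullDist (convexHull ℝ (range V)) (X n) ω ∂(P n)) atTop
      (𝓝 (∫ z, maxCornerDist (fun k => V (k - 1) - V k) (fun k => V (k + 1) - V k) z
        ∂expPi (Fin M × Bool) (1 / M))) := by
  have hM : (0 : ℝ) < M := by exact_mod_cast NeZero.pos M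
  have hr : (0 : ℝ) < 1 / M := by positivity
  have hD := h.pos'
  set F := maxCornerDist (fun k => V (k - 1) - V k) (fun k => V (k + 1) - V k) with hF
  have hFc : Continuous F := continuous_maxCornerDist _ _
  set Z : ∀ n, Ω n → Fin M × Bool → ℝ :=
    fun n ω i => n * minSideCoord V ℓ (fun j => X n j ω) i with hZ
  have hZm : ∀ n, Measurable (Z n) := fun n => measurable_pi_lambda _ fun i =>
    (measurable_minSideCoord (hX n).measurable i).const_mul _
  have hZp : ∀ n, IsProbabilityMeasure ((P n).map (Z n)) := fun n =>
    Measure.isProbabilityMeasure_map (hZm n).aemeasurable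
  set μ : ℕ → ProbabilityMeasure (Fin M × Bool → ℝ) := fun n => ⟨(P n).map (Z n), hZp n⟩ with hμ
  have i1 := isProbabilityMeasure_expPi (Fin M × Bool) hr
  set ν : ProbabilityMeasure (Fin M × Bool → ℝ) := ⟨expPi (Fin M × Bool) (1 / M), i1⟩ with hν
  have hsurv : ∀ a : Fin M × Bool → ℝ, MeasurableSet {x : Fin M × Bool → ℝ | ∀ i, a i < x i} := by
    intro a
    simp only [ofPred_forall]
    exact MeasurableSet.iInter fun i => measurableSet_lt measurable_const (measurable_pi_apply i)
  have hweak : Tendsto μ atTop (𝓝 ν) := by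
    refine tendsto_probabilityMeasure_of_tendsto_survival fun a => ?_
    have e1 : (ν : Measure (Fin M × Bool → ℝ)).real {x | ∀ i, a i < x i} =
        Real.exp (-(∑ i, max (a i) 0) / M) := by
      refine (expPi_real_survival hr a).trans ?_
      congr 1
      ring
    rw [e1]
    -- The exact survival formula is (1 + x/n)ⁿ with x = -(∑ aᵢ⁺)/M, valid once all aᵢ/n ≤ 1/2.
    refine (Real.tendsto_one_add_div_pow_exp _).congr' ?_
    have hev : ∀ᶠ n : ℕ in atTop, ∀ i, a i / n ≤ 1 / 2 := by
      refine eventually_all.2 fun i => ?_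
      exact (tendsto_const_div_atTop_nhds_zero_nat (a i)).eventually_le_const (by norm_num)
    filter_upwards [hev, eventually_gt_atTop 0] with n hn hn0
    have : NeZero n := ⟨hn0.ne'⟩
    have hn0' : (0 : ℝ) < n := by exact_mod_cast hn0
    have e2 : (μ n : Measure (Fin M × Bool → ℝ)).real {x | ∀ i, a i < x i} =
        (P n).real {ω | ∀ i, a i / n < minSideCoord V ℓ (fun j => X n j ω) i} := by
      refine (map_measureReal_apply (hZm n) (hsurv a)).trans ?_
      congr 1
      ext ω
      simp only [hZ, mem_preimage, mem_ofPred_eq]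
      exact forall_congr' fun i => (div_lt_iff₀' hn0').symm
    rw [e2, h.measureReal_minSideCoord (hX n) hn]
    have e3 : ∀ i, max (a i / n) 0 = max (a i) 0 / n := fun i => by
      rw [← max_div_div_right hn0'.le, zero_div]
    simp only [e3, ← Finset.sum_div]
    congr 1
    field_simp
    ring
  -- The constants come from a union bound over the M vertices using one coordinate at each, at
  -- level t/D. This is crude, but only domination uniform in n matters.
  have hlim := tendsto_integral_of_exp_tail hweak hFc (maxCornerDist_nonneg _ _)
    (C := M) (c := 1 / (2 * M * D)) hM.le (by positivity) ?_ ?_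
  · have e : ∀ n, ∫ x, F x ∂(μ n : Measure (Fin M × Bool → ℝ)) = ∫ ω, F (Z n ω) ∂(P n) := fun n =>
      integral_map (hZm n).aemeasurable hFc.aestronglyMeasurable
    simp only [e] at hlim
    have hdiff : Tendsto (fun n : ℕ =>
        (n : ℝ) * ∫ ω, hullDist (convexHull ℝ (range V)) (X n) ω ∂(P n) -
          ∫ ω, F (Z n ω) ∂(P n)) atTop (𝓝 0) := by
      have hb := (tendsto_natCast_mul_exp_neg (c := 1 / (4 * M)) (by positivity)).const_mul
        ((Metric.diam (convexHull ℝ (range V)) + D) * (2 * M))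
      rw [mul_zero] at hb
      refine squeeze_zero_norm' ?_ hb
      filter_upwards [eventually_gt_atTop 0] with n hn0
      have : NeZero n := ⟨hn0.ne'⟩
      exact h.abs_integral_hullDist_sub_le (hX n)
    have := hdiff.add hlim
    simp only [sub_add_cancel, zero_add] at this
    exact this
  · filter_upwards [eventually_gt_atTop 0] with n hn0 t ht
    have : NeZero n := ⟨hn0.ne'⟩
    have hFm : MeasurableSet {x | t < F x} := measurableSet_lt measurable_const hFc.measurable
    have e : (μ n : Measure (Fin M × Bool → ℝ)).real {x | t < F x} =
      (P n).real (Z n ⁻¹' {x | t < F x}) := map_measureReal_apply (hZm n) hFm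
    rw [e]
    have hsub : Z n ⁻¹' {x | t < F x} ⊆ ⋃ k : Fin M, {ω | t / D < Z n ω (k, true)} := by
      intro ω hω
      obtain ⟨k, hk⟩ := exists_lt_of_lt_maxCornerDist hD h.norm_eq (fun i =>
        mul_nonneg n.cast_nonneg (h.minSideCoord_mem_Icc (fun j => X n j ω) i).1) hω
      exact mem_iUnion.2 ⟨k, hk true⟩
    refine (measureReal_mono hsub).trans ((measureReal_iUnion_fintype_le _).trans ?_)
    refine (Finset.sum_le_sum fun k _ =>
      h.measureReal_lt_mul_minSideCoord_le (hX n) (k, true) (div_pos ht hD)).trans (le_of_eq ?_)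
    rw [Finset.sum_const, Finset.card_univ, Fintype.card_fin, nsmul_eq_mul]
    congr 2
    field_simp
  · intro t ht
    have h3 : (expPi (Fin M × Bool) (1 / M)).real {x | t < F x} ≤
        (expPi (Fin M × Bool) (1 / M)).real {x | ∃ k, ∀ b, t / D < x (k, b)} := by
      refine ENNReal.toReal_mono (measure_ne_top _ _) (measure_mono_ae ?_)
      filter_upwards [expPi_ae_nonneg (Fin M × Bool) hr] with z hz hlt
      exact exists_lt_of_lt_maxCornerDist hD h.norm_eq hz hlt
    refine h3.trans ((expPi_real_exists_pair_le hr (by positivity)).trans ?_)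
    rw [Fintype.card_fin]
    refine mul_le_mul_of_nonneg_left (Real.exp_le_exp.2 ?_) hM.le
    have : 0 ≤ t / (M * D) := by positivity
    have e1 : -(2 * (1 / (M : ℝ))) * (t / D) = -2 * (t / (M * D)) := by field_simp
    have e2 : -(1 / (2 * (M : ℝ) * D)) * t = -(1 / 2) * (t / (M * D)) := by field_simp
    rw [e1, e2]
    linarith

end IsEquilateralPolygon

/-! ### Trigonometry of regular polygons. -/

/-- The unit vector at angle `x`. -/
noncomputable def unitVec (x : ℝ) : Plane := !₂[Real.cos x, Real.sin x]

theorem circlePoint_eq (p : Plane) (R x : ℝ) : circlePoint p R x = p + R • unitVec x := by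
  ext i
  fin_cases i <;> simp [circlePoint, unitVec]

theorem norm_unitVec (x : ℝ) : ‖unitVec x‖ = 1 := by
  simp [unitVec, EuclideanSpace.norm_eq]

theorem inner_unitVec (x y : ℝ) : inner ℝ (unitVec x) (unitVec y) = Real.cos (x - y) := by
  simp [unitVec, PiLp.inner_apply, Real.cos_sub]
  ring

theorem unitVec_add_sub (x h : ℝ) :
    unitVec (x + 2 * h) - unitVec x = (2 * Real.sin h) • unitVec (x + h + Real.pi / 2) := by
  obtain ⟨c, rfl⟩ : ∃ c, x = c - h := ⟨x + h, by ring⟩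
  have e1 : c - h + 2 * h = c + h := by ring
  have e2 : c - h + h = c := by ring
  rw [e1, e2]
  ext i
  fin_cases i
  · simp [unitVec, Real.cos_add c, Real.cos_sub c]
    ring
  · simp [unitVec, Real.sin_add c, Real.sin_sub c]
    ring

theorem unitVec_sub_add (x h : ℝ) :
    (unitVec (x - h) - unitVec x) + (unitVec (x + h) - unitVec x) =
      -(2 * (1 - Real.cos h)) • unitVec x := by
  ext i
  fin_cases i
  · simp [unitVec, Real.cos_add, Real.cos_sub]
    ring
  · simp [unitVec, Real.sin_add, Real.sin_sub]
    ring

/-- Every unit vector at an angle between two others is a combination of those. -/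
theorem sin_smul_unitVec (x h t : ℝ) :
    Real.sin h • unitVec (x + t) = Real.sin (h - t) • unitVec x + Real.sin t • unitVec (x + h) := by
  ext i
  fin_cases i
  · simp [unitVec, Real.cos_add, Real.sin_sub]
    ring
  · simp [unitVec, Real.sin_add, Real.sin_sub]
    ring

/-- With y = d·h this expands the chord from a vertex to the d-th next one in the two edges at that
vertex; it supplies the coefficients in `regularVertex_mem_cone`. -/
theorem sin_smul_unitVec_sub (x h y : ℝ) :
    (Real.sin h * Real.sin (2 * h)) • (unitVec (x + 2 * y) - unitVec x) =
      (Real.sin y * Real.sin (y - h)) • (unitVec (x - 2 * h) - unitVec x) +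
      (Real.sin y * Real.sin (y + h)) • (unitVec (x + 2 * h) - unitVec x) := by
  have h1 := unitVec_add_sub x y
  have h2 := unitVec_add_sub x h
  have h3 := unitVec_add_sub x (-h)
  have e : x + 2 * -h = x - 2 * h := by ring
  rw [e] at h3
  rw [h1, h2, h3]
  ext i
  fin_cases i
  · simp [unitVec, Real.cos_add, Real.sin_add, Real.sin_sub, Real.sin_two_mul]
    ring
  · simp [unitVec, Real.cos_add, Real.sin_add, Real.sin_sub, Real.sin_two_mul]
    ring

theorem exists_eq_smul_unitVec (x : Plane) : ∃ ρ τ : ℝ, 0 ≤ ρ ∧ x = ρ • unitVec τ := by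
  refine ⟨‖(⟨x 0, x 1⟩ : ℂ)‖, Complex.arg ⟨x 0, x 1⟩, norm_nonneg _, ?_⟩
  ext i
  fin_cases i
  · simp [unitVec, Complex.norm_mul_cos_arg]
  · simp [unitVec, Complex.norm_mul_sin_arg]

/-- The vertices of a regular polygon, indexed by all integers. -/
noncomputable def regularVertex (M : ℕ) (p : Plane) (R θ : ℝ) (m : ℤ) : Plane :=
  p + R • unitVec (θ + 2 * (m * (Real.pi / M)))

section

variable {M : ℕ} {p : Plane} {R θ : ℝ}

/-- Allows index arithmetic in ℤ, free of wrap-around, and a return to `Fin M` at the end. -/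
theorem regularVertex_congr (hM : 0 < M) {m m' : ℤ} (h : m ≡ m' [ZMOD M]) :
    regularVertex M p R θ m = regularVertex M p R θ m' := by
  obtain ⟨c, hc⟩ := h.dvd
  obtain rfl : m' = m + M * c := by linarith
  have hM' : (M : ℝ) ≠ 0 := by positivity
  have e : θ + 2 * (((m + M * c : ℤ) : ℝ) * (Real.pi / M)) =
      θ + 2 * (m * (Real.pi / M)) + c * (2 * Real.pi) := by
    push_cast
    field_simp
    ring
  have e2 : ∀ x : ℝ, unitVec (x + c * (2 * Real.pi)) = unitVec x := fun x => by
    simp [unitVec]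
  rw [regularVertex, regularVertex, e, e2]

theorem val_add_one_modEq [NeZero M] (k : Fin M) :
    (((k + 1 : Fin M) : ℕ) : ℤ) ≡ (k : ℕ) + 1 [ZMOD M] := by
  have : ((k + 1 : Fin M) : ℕ) ≡ (k : ℕ) + 1 [MOD M] := by
    rw [Fin.val_add, Nat.ModEq, Nat.mod_mod, Nat.add_mod, Fin.val_one', Nat.mod_mod, ← Nat.add_mod]
  exact_mod_cast (Int.natCast_modEq_iff.2 this)

theorem val_sub_one_modEq [NeZero M] (k : Fin M) :
    (((k - 1 : Fin M) : ℕ) : ℤ) ≡ (k : ℕ) - 1 [ZMOD M] := by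
  have := (val_add_one_modEq (k - 1)).symm.sub_right 1
  simpa using this

theorem sin_mul_pi_div_nonneg {d : ℝ} (h0 : 0 ≤ d) (hd : d ≤ M) :
    0 ≤ Real.sin (d * (Real.pi / M)) := by
  have := Real.pi_pos
  rcases Nat.eq_zero_or_pos M with rfl | hM
  · simp
  have hM' : (0 : ℝ) < M := by exact_mod_cast hM
  refine Real.sin_nonneg_of_nonneg_of_le_pi (by positivity) ?_
  rw [mul_div_assoc', div_le_iff₀ hM']
  nlinarith

theorem sin_mul_pi_div_pos {d : ℝ} (h0 : 0 < d) (hd : d < M) :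
    0 < Real.sin (d * (Real.pi / M)) := by
  have := Real.pi_pos
  have hM' : (0 : ℝ) < M := h0.trans hd
  refine Real.sin_pos_of_pos_of_lt_pi (by positivity) ?_
  rw [mul_div_assoc', div_lt_iff₀ hM']
  nlinarith

theorem sin_pi_div_le_sin_mul {d : ℝ} (h0 : 1 ≤ d) (hd : d ≤ M - 1) :
    Real.sin (Real.pi / M) ≤ Real.sin (d * (Real.pi / M)) := by
  have := Real.pi_pos
  have hM' : (0 : ℝ) < M := by linarith
  have hx : 0 < Real.pi / M := by positivity
  have hMx : M * (Real.pi / M) = Real.pi := by field_simp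
  have h2 : 2 * (Real.pi / M) ≤ Real.pi := by nlinarith
  rcases le_total (d * (Real.pi / M)) (Real.pi / 2) with h | h
  · exact Real.sin_le_sin_of_le_of_le_pi_div_two (by linarith) h (by nlinarith)
  · rw [← Real.sin_pi_sub (d * (Real.pi / M))]
    exact Real.sin_le_sin_of_le_of_le_pi_div_two (by linarith) (by linarith) (by nlinarith)

end

/-! ### The boundary of a regular polygon. -/

section

variable {M : ℕ} {p : Plane} {R θ : ℝ}

/-- The component of `x - p` in the direction of the outer normal of the side between the vertices
`m` and `m + 1`. -/
noncomputable def sideHeight (M : ℕ) (p : Plane) (θ : ℝ) (m : ℤ) (x : Plane) : ℝ :=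
  inner ℝ (x - p) (unitVec (θ + (2 * m + 1) * (Real.pi / M)))

/-- The product form shows that vertices stay below the apothem: for an integer d with |d| < M, the
sines of d·π/M and (d - 1)·π/M never have opposite signs. -/
theorem sideHeight_regularVertex (m j : ℤ) :
    sideHeight M p θ m (regularVertex M p R θ j) = R * Real.cos (Real.pi / M) -
      2 * R * (Real.sin ((j - m : ℤ) * (Real.pi / M)) *
        Real.sin ((j - m - 1 : ℤ) * (Real.pi / M))) := by
  have e : θ + 2 * (j * (Real.pi / M)) - (θ + (2 * m + 1) * (Real.pi / M)) =
      (j - m : ℤ) * (Real.pi / M) + (j - m - 1 : ℤ) * (Real.pi / M) := by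
    push_cast; ring
  have e2 : Real.pi / M = (j - m : ℤ) * (Real.pi / M) - (j - m - 1 : ℤ) * (Real.pi / M) := by
    push_cast; ring
  rw [sideHeight, regularVertex, add_sub_cancel_left, real_inner_smul_left, inner_unitVec, e]
  nth_rewrite 3 [e2]
  rw [Real.cos_add, Real.cos_sub]
  ring

theorem sideHeight_combo (m : ℤ) (x y : Plane) (s t : ℝ) :
    sideHeight M p θ m (p + s • (x - p) + t • (y - p)) =
      s * sideHeight M p θ m x + t * sideHeight M p θ m y := by
  simp only [sideHeight]
  rw [add_assoc, add_sub_cancel_left, inner_add_left, real_inner_smul_left, real_inner_smul_left]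

theorem sideHeight_combo' (m : ℤ) (x y : Plane) {s t : ℝ} (h : s + t = 1) :
    sideHeight M p θ m (s • x + t • y) =
      s * sideHeight M p θ m x + t * sideHeight M p θ m y := by
  rw [← sideHeight_combo]
  congr 1
  have : p = s • p + t • p := by rw [← add_smul, h, one_smul]
  nth_rewrite 1 [this]
  simp only [smul_sub]
  abel

theorem sideHeight_le (m : ℤ) (x y : Plane) :
    sideHeight M p θ m y ≤ sideHeight M p θ m x + dist y x := by
  have e : sideHeight M p θ m y = sideHeight M p θ m x +
      inner ℝ (y - x) (unitVec (θ + (2 * m + 1) * (Real.pi / M))) := by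
    simp only [sideHeight]
    rw [← inner_add_left]
    congr 1
    abel
  rw [e, dist_eq_norm]
  gcongr
  refine (real_inner_le_norm _ _).trans (le_of_eq ?_)
  rw [norm_unitVec, mul_one]

theorem sideHeight_regularVertex_le [NeZero M] (hR : 0 ≤ R) (k j : Fin M) :
    sideHeight M p θ (k : ℕ) (regularVertex M p R θ (j : ℕ)) ≤ R * Real.cos (Real.pi / M) := by
  rw [sideHeight_regularVertex]
  have hj : ((j : ℕ) : ℝ) + 1 ≤ M := by exact_mod_cast j.2
  have hk : ((k : ℕ) : ℝ) + 1 ≤ M := by exact_mod_cast k.2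
  have hj0 : (0 : ℝ) ≤ (j : ℕ) := Nat.cast_nonneg _
  have hk0 : (0 : ℝ) ≤ (k : ℕ) := Nat.cast_nonneg _
  have key : 0 ≤ Real.sin (((j : ℕ) - (k : ℕ) : ℤ) * (Real.pi / M)) *
        Real.sin (((j : ℕ) - (k : ℕ) - 1 : ℤ) * (Real.pi / M)) := by
    push_cast
    rcases lt_or_ge k j with h | h
    · have h' : ((k : ℕ) : ℝ) + 1 ≤ (j : ℕ) := by exact_mod_cast h
      exact mul_nonneg (sin_mul_pi_div_nonneg (by linarith) (by linarith))
        (sin_mul_pi_div_nonneg (by linarith) (by linarith))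
    · have h' : ((j : ℕ) : ℝ) ≤ (k : ℕ) := by exact_mod_cast h
      rw [← neg_mul_neg, ← Real.sin_neg, ← Real.sin_neg, ← neg_mul, ← neg_mul]
      exact mul_nonneg (sin_mul_pi_div_nonneg (by linarith) (by linarith))
        (sin_mul_pi_div_nonneg (by linarith) (by linarith))
  nlinarith [mul_nonneg hR key]

theorem sin_pi_div_pos (hM : 2 ≤ M) : 0 < Real.sin (Real.pi / M) := by
  have : (2 : ℝ) ≤ M := by exact_mod_cast hM
  simpa using sin_mul_pi_div_pos (M := M) (d := 1) one_pos (by linarith)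

theorem cos_pi_div_pos (hM : 3 ≤ M) : 0 < Real.cos (Real.pi / M) := by
  have hM' : (3 : ℝ) ≤ M := by exact_mod_cast hM
  have := Real.pi_pos
  have h0 : 0 < Real.pi / M := by positivity
  refine Real.cos_pos_of_mem_Ioo ⟨by linarith, ?_⟩
  exact div_lt_div_of_pos_left Real.pi_pos two_pos (by linarith)

/-- Every point of the plane lies in one of the sectors spanned by adjacent vertices. -/
theorem exists_sector [NeZero M] (hM : 3 ≤ M) (hR : 0 < R) (x : Plane) :
    ∃ (k : Fin M) (s t : ℝ), 0 ≤ s ∧ 0 ≤ t ∧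
      x = p + s • (regularVertex M p R θ (k : ℕ) - p) +
        t • (regularVertex M p R θ ((k : ℕ) + 1) - p) := by
  have hM' : (3 : ℝ) ≤ M := by exact_mod_cast hM
  have hpi := Real.pi_pos
  have hM0 : 0 < M := by omega
  set h := Real.pi / M with hh
  have h0 : 0 < h := by positivity
  have hsin : 0 < Real.sin (2 * h) := sin_mul_pi_div_pos two_pos (by linarith)
  obtain ⟨ρ, τ, hρ, hx⟩ := exists_eq_smul_unitVec (x - p)
  -- The sector is found by rounding the polar angle down to a multiple of 2π/M; its index is then
  -- reduced modulo M.
  set m : ℤ := ⌊(τ - θ) / (2 * h)⌋ with hm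
  have hm1 : (m : ℝ) * (2 * h) ≤ τ - θ := by
    rw [← le_div_iff₀ (by positivity)]
    exact Int.floor_le _
  have hm2 : τ - θ < ((m : ℝ) + 1) * (2 * h) := by
    rw [← div_lt_iff₀ (by positivity)]
    exact Int.lt_floor_add_one _
  set t := τ - θ - m * (2 * h) with ht
  have hM2 : 2 * h ≤ Real.pi := by
    rw [hh, mul_div_assoc', div_le_iff₀ (by linarith)]
    nlinarith
  have ht0 : 0 ≤ Real.sin t := Real.sin_nonneg_of_nonneg_of_le_pi (by linarith) (by linarith)
  have ht1 : 0 ≤ Real.sin (2 * h - t) :=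
    Real.sin_nonneg_of_nonneg_of_le_pi (by linarith) (by linarith)
  have hsmul := sin_smul_unitVec (θ + 2 * (m * h)) (2 * h) t
  have e1 : θ + 2 * (m * h) + t = τ := by rw [ht]; ring
  have e2 : θ + 2 * (m * h) + 2 * h = θ + 2 * (((m + 1 : ℤ) : ℝ) * h) := by push_cast; ring
  rw [e1, e2] at hsmul
  have hmod : ((m % M).toNat : ℤ) = m % M := Int.toNat_of_nonneg (Int.emod_nonneg _ (by omega))
  have hlt : (m % M).toNat < M := by
    have := Int.emod_lt_of_pos m (b := M) (by omega)
    omega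
  refine ⟨⟨(m % M).toNat, hlt⟩, ρ * Real.sin (2 * h - t) / (R * Real.sin (2 * h)),
    ρ * Real.sin t / (R * Real.sin (2 * h)), by positivity, by positivity, ?_⟩
  have c1 : regularVertex M p R θ ((m % M).toNat : ℕ) = regularVertex M p R θ m := by
    refine regularVertex_congr hM0 ?_
    rw [hmod]
    exact Int.mod_modEq _ _
  have c2 : regularVertex M p R θ (((m % M).toNat : ℕ) + 1) = regularVertex M p R θ (m + 1) := by
    refine regularVertex_congr hM0 ?_
    rw [hmod]
    exact (Int.mod_modEq _ _).add_right 1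
  rw [c1, c2]
  simp only [regularVertex, add_sub_cancel_left, smul_smul]
  have d1 : ρ * Real.sin (2 * h - t) / (R * Real.sin (2 * h)) * R =
      ρ / Real.sin (2 * h) * Real.sin (2 * h - t) := by field_simp
  have d2 : ρ * Real.sin t / (R * Real.sin (2 * h)) * R =
      ρ / Real.sin (2 * h) * Real.sin t := by field_simp
  rw [d1, d2, add_assoc, mul_smul, mul_smul, ← smul_add, ← hsmul, smul_smul,
    div_mul_cancel₀ _ hsin.ne', ← hx]
  abel

theorem regularVertex_val_add_one [NeZero M] (k : Fin M) :
    regularVertex M p R θ ((k + 1 : Fin M) : ℕ) = regularVertex M p R θ ((k : ℕ) + 1) :=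
  regularVertex_congr (NeZero.pos M) (val_add_one_modEq k)

theorem regularVertex_val_sub_one [NeZero M] (k : Fin M) :
    regularVertex M p R θ ((k - 1 : Fin M) : ℕ) = regularVertex M p R θ ((k : ℕ) - 1) :=
  regularVertex_congr (NeZero.pos M) (val_sub_one_modEq k)

theorem sideHeight_self (m : ℤ) :
    sideHeight M p θ m (regularVertex M p R θ m) = R * Real.cos (Real.pi / M) := by
  simp [sideHeight_regularVertex]

theorem sideHeight_add_one (m : ℤ) :
    sideHeight M p θ m (regularVertex M p R θ (m + 1)) = R * Real.cos (Real.pi / M) := by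
  simp [sideHeight_regularVertex]

theorem sideHeight_le_of_mem_convexHull [NeZero M] (hR : 0 ≤ R) (k : Fin M) {x : Plane}
    (hx : x ∈ convexHull ℝ (range fun j : Fin M => regularVertex M p R θ (j : ℕ))) :
    sideHeight M p θ (k : ℕ) x ≤ R * Real.cos (Real.pi / M) := by
  have : convexHull ℝ (range fun j : Fin M => regularVertex M p R θ (j : ℕ)) ⊆
      {x | sideHeight M p θ (k : ℕ) x ≤ R * Real.cos (Real.pi / M)} := by
    refine convexHull_min ?_ ?_
    · rintro _ ⟨j, rfl⟩
      exact sideHeight_regularVertex_le hR k j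
    · intro x hx y hy s t hs ht hst
      change sideHeight M p θ _ _ ≤ _
      rw [sideHeight_combo' _ _ _ hst]
      calc _ ≤ s * (R * Real.cos (Real.pi / M)) + t * (R * Real.cos (Real.pi / M)) := by
            gcongr
            · exact hx
            · exact hy
        _ = _ := by rw [← add_mul, hst, one_mul]
  exact this hx

/-- The reflection of vertex 0 in the center lies in some sector, which writes the center as a
convex combination of three vertices. -/
theorem center_mem_convexHull [NeZero M] (hM : 3 ≤ M) (hR : 0 < R) :
    p ∈ convexHull ℝ (range fun j : Fin M => regularVertex M p R θ (j : ℕ)) := by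
  set V := fun j : Fin M => regularVertex M p R θ (j : ℕ) with hV
  obtain ⟨k, s, t, hs, ht, h⟩ := exists_sector (p := p) (θ := θ) hM hR (p - (V 0 - p))
  rw [← regularVertex_val_add_one] at h
  have hc : ∀ j, V j ∈ convexHull ℝ (range V) := fun j => subset_convexHull ℝ _ (mem_range_self j)
  have hpos : 0 < 1 + s + t := by positivity
  have := (convex_convexHull ℝ (range V)).sum_mem (t := Finset.univ)
    (w := ![1 / (1 + s + t), s / (1 + s + t), t / (1 + s + t)]) (z := ![V 0, V k, V (k + 1)])
    (by intro i _; fin_cases i <;> simp <;> positivity)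
    (by simp [Fin.sum_univ_three]; field_simp)
    (by intro i _; fin_cases i <;> simp [hc])
  convert! this using 1
  have h' : (1 + s + t) • p = V 0 + s • V k + t • V (k + 1) := by
    have e : p - (V 0 - p) = p + s • (V k - p) + t • (V (k + 1) - p) := h
    have e2 : V 0 = p + p - (p + s • (V k - p) + t • (V (k + 1) - p)) := by
      rw [← e]; abel
    rw [e2, add_smul, add_smul, one_smul]
    simp only [smul_sub]
    abel
  simp only [Fin.sum_univ_three, Matrix.cons_val_zero, Matrix.cons_val_one, Matrix.cons_val_two,
    Matrix.head_cons, Matrix.tail_cons]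
  have e3 : ∀ a : ℝ, a / (1 + s + t) = (1 + s + t)⁻¹ * a := fun a => by ring
  rw [e3, e3 s, e3 t, mul_smul, mul_smul, mul_smul, one_smul, ← smul_add, ← smul_add, ← h',
    smul_smul, inv_mul_cancel₀ hpos.ne', one_smul]

theorem mem_convexHull_of_sector [NeZero M] (hM : 3 ≤ M) (hR : 0 < R) (k : Fin M) {s t : ℝ}
    (hs : 0 ≤ s) (ht : 0 ≤ t) (hst : s + t ≤ 1) :
    p + s • (regularVertex M p R θ (k : ℕ) - p) + t • (regularVertex M p R θ ((k : ℕ) + 1) - p) ∈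
      convexHull ℝ (range fun j : Fin M => regularVertex M p R θ (j : ℕ)) := by
  rw [← regularVertex_val_add_one]
  set V := fun j : Fin M => regularVertex M p R θ (j : ℕ) with hV
  have hc : ∀ j, V j ∈ convexHull ℝ (range V) := fun j => subset_convexHull ℝ _ (mem_range_self j)
  have hp : p ∈ convexHull ℝ (range V) := center_mem_convexHull hM hR
  have := (convex_convexHull ℝ (range V)).sum_mem (t := Finset.univ)
    (w := ![1 - s - t, s, t]) (z := ![p, V k, V (k + 1)])
    (by intro i _; fin_cases i <;> simp <;> linarith)
    (by simp [Fin.sum_univ_three]; ring)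
    (by intro i _; fin_cases i <;> simp [hc, hp])
  convert! this using 1
  simp only [Fin.sum_univ_three, Matrix.cons_val_zero, Matrix.cons_val_one, Matrix.cons_val_two,
    Matrix.head_cons, Matrix.tail_cons, sub_smul, one_smul, smul_sub]
  simp only [hV]
  abel

/-- The boundary of a regular polygon is the union of its sides. -/
theorem frontier_regularPolygon [NeZero M] (hM : 3 ≤ M) (hR : 0 < R) :
    frontier (convexHull ℝ (range fun j : Fin M => regularVertex M p R θ (j : ℕ))) =
      ⋃ k : Fin M, segment ℝ (regularVertex M p R θ (k : ℕ))
        (regularVertex M p R θ ((k + 1 : Fin M) : ℕ)) := by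
  set V := fun j : Fin M => regularVertex M p R θ (j : ℕ) with hV
  have hr : 0 < R * Real.cos (Real.pi / M) := mul_pos hR (cos_pi_div_pos hM)
  have hclosed : IsClosed (convexHull ℝ (range V)) :=
    ((finite_range V).isCompact_convexHull ℝ).isClosed
  refine Subset.antisymm ?_ ?_
  · intro x hx
    have hxQ := hclosed.frontier_subset hx
    obtain ⟨k, s, t, hs, ht, h⟩ := exists_sector (p := p) (θ := θ) hM hR x
    have hk := sideHeight_le_of_mem_convexHull hR.le k hxQ
    have hst : s + t ≤ 1 := by
      rw [h, sideHeight_combo, sideHeight_self, sideHeight_add_one, ← add_mul] at hk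
      nlinarith
    refine mem_iUnion.2 ⟨k, ?_⟩
    rw [regularVertex_val_add_one]
    rcases hst.eq_or_lt with hst | hst
    · refine ⟨s, t, hs, ht, hst, ?_⟩
      rw [h]
      have : p = s • p + t • p := by rw [← add_smul, hst, one_smul]
      nth_rewrite 3 [this]
      simp only [smul_sub]
      abel
    · exfalso
      -- If s + t < 1, all side heights of `x` stay below the apothem by a fixed margin. Heights are
      -- 1-Lipschitz, so a ball of that radius stays in the polygon.
      have hlt : ∀ j : Fin M, sideHeight M p θ (j : ℕ) x ≤
          (s + t) * (R * Real.cos (Real.pi / M)) := by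
        intro j
        rw [h, sideHeight_combo, add_mul, ← regularVertex_val_add_one]
        gcongr
        · exact sideHeight_regularVertex_le hR.le j k
        · exact sideHeight_regularVertex_le hR.le j (k + 1)
      refine hx.2 (mem_interior_iff_mem_nhds.2 (Metric.mem_nhds_iff.2
        ⟨(1 - (s + t)) * (R * Real.cos (Real.pi / M)), mul_pos (by linarith) hr, fun y hy => ?_⟩))
      obtain ⟨j, s', t', hs', ht', h'⟩ := exists_sector (p := p) (θ := θ) hM hR y
      have hy1 : sideHeight M p θ (j : ℕ) y ≤ R * Real.cos (Real.pi / M) := by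
        have h1 := sideHeight_le (M := M) (p := p) (θ := θ) (j : ℕ) x y
        have h2 := hlt j
        have h3 : dist y x < _ := hy
        linarith
      rw [h', sideHeight_combo, sideHeight_self, sideHeight_add_one, ← add_mul] at hy1
      rw [h']
      exact mem_convexHull_of_sector hM hR j hs' ht' (by nlinarith)
  · refine iUnion_subset fun k x hx => ?_
    have hxQ : x ∈ convexHull ℝ (range V) :=
      (convex_convexHull ℝ (range V)).segment_subset
        (subset_convexHull ℝ _ (mem_range_self k))
        (subset_convexHull ℝ _ (mem_range_self (k + 1))) hx
    refine ⟨subset_closure hxQ, fun hint => ?_⟩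
    obtain ⟨ε, hε, hb⟩ := Metric.mem_nhds_iff.1 (mem_interior_iff_mem_nhds.1 hint)
    have hval : sideHeight M p θ (k : ℕ) x = R * Real.cos (Real.pi / M) := by
      obtain ⟨s, t, hs, ht, hst, rfl⟩ := hx
      rw [sideHeight_combo' _ _ _ hst, regularVertex_val_add_one, sideHeight_self,
        sideHeight_add_one, ← add_mul, hst, one_mul]
    set e := unitVec (θ + (2 * ((k : ℕ) : ℤ) + 1) * (Real.pi / M)) with he
    -- A small step along the outer normal would raise the height above the apothem.
    have hmem : x + (ε / 2) • e ∈ convexHull ℝ (range V) := by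
      refine hb ?_
      rw [Metric.mem_ball, dist_eq_norm, add_sub_cancel_left, norm_smul, norm_unitVec,
        Real.norm_of_nonneg (by positivity)]
      linarith
    have h1 := sideHeight_le_of_mem_convexHull hR.le k hmem
    have h2 : sideHeight M p θ (k : ℕ) (x + (ε / 2) • e) =
        sideHeight M p θ (k : ℕ) x + ε / 2 := by
      simp only [sideHeight]
      have : x + (ε / 2) • e - p = (x - p) + (ε / 2) • e := by abel
      rw [this, inner_add_left, real_inner_smul_left, ← he, real_inner_self_eq_norm_sq, he,
        norm_unitVec]
      ring
    linarith

end

/-! ### Regular polygons are equilateral polygons in the above sense. -/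

section

variable {M : ℕ} {p : Plane} {R θ : ℝ}

theorem dist_regularVertex_add_one (hM : 2 ≤ M) (hR : 0 < R) (m : ℤ) :
    dist (regularVertex M p R θ m) (regularVertex M p R θ (m + 1)) =
      2 * R * Real.sin (Real.pi / M) := by
  have e : θ + 2 * (((m + 1 : ℤ) : ℝ) * (Real.pi / M)) =
      θ + 2 * (m * (Real.pi / M)) + 2 * (Real.pi / M) := by push_cast; ring
  have hs := sin_pi_div_pos hM
  rw [dist_comm, dist_eq_norm, regularVertex, regularVertex, add_sub_add_left_eq_sub, ← smul_sub,
    e, unitVec_add_sub, norm_smul, norm_smul, norm_unitVec, Real.norm_of_nonneg hR.le,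
    Real.norm_of_nonneg (by positivity)]
  ring

theorem norm_regularVertex_sub_add (hR : 0 < R) (m : ℤ) :
    ‖(regularVertex M p R θ (m - 1) - regularVertex M p R θ m) +
      (regularVertex M p R θ (m + 1) - regularVertex M p R θ m)‖ =
      2 * R * Real.sin (Real.pi / M) * (2 * Real.sin (Real.pi / M)) := by
  have e : θ + 2 * (((m + 1 : ℤ) : ℝ) * (Real.pi / M)) =
      θ + 2 * (m * (Real.pi / M)) + 2 * (Real.pi / M) := by push_cast; ring
  have e' : θ + 2 * (((m - 1 : ℤ) : ℝ) * (Real.pi / M)) =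
      θ + 2 * (m * (Real.pi / M)) - 2 * (Real.pi / M) := by push_cast; ring
  simp only [regularVertex]
  rw [add_sub_add_left_eq_sub, add_sub_add_left_eq_sub, ← smul_sub, ← smul_sub, ← smul_add, e, e',
    unitVec_sub_add, norm_smul, norm_smul, norm_unitVec, Real.norm_of_nonneg hR.le, norm_neg,
    Real.norm_of_nonneg (by linarith [Real.cos_le_one (2 * (Real.pi / M))]), Real.cos_two_mul,
    Real.cos_sq']
  ring

theorem regularVertex_mem_cone [NeZero M] (hM : 3 ≤ M) {m d : ℤ} (h1 : 1 ≤ d) (h2 : d + 1 ≤ M) :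
    ∃ α β : ℝ, 0 ≤ α ∧ 0 ≤ β ∧ 1 ≤ α + β ∧ regularVertex M p R θ (m + d) =
      regularVertex M p R θ m + α • (regularVertex M p R θ (m - 1) - regularVertex M p R θ m) +
        β • (regularVertex M p R θ (m + 1) - regularVertex M p R θ m) := by
  have hM' : (3 : ℝ) ≤ M := by exact_mod_cast hM
  have h1' : (1 : ℝ) ≤ d := by exact_mod_cast h1
  have h2' : (d : ℝ) + 1 ≤ M := by exact_mod_cast h2
  set h := Real.pi / M with hh
  set a := θ + 2 * (m * h) with ha
  have e1 : θ + 2 * (((m + 1 : ℤ) : ℝ) * h) = a + 2 * h := by push_cast; ring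
  have e2 : θ + 2 * (((m - 1 : ℤ) : ℝ) * h) = a - 2 * h := by push_cast; ring
  have e3 : θ + 2 * (((m + d : ℤ) : ℝ) * h) = a + 2 * (d * h) := by push_cast; ring
  have s1 : 0 < Real.sin h := sin_pi_div_pos (by omega)
  have c1 : 0 < Real.cos h := cos_pi_div_pos hM
  have s2 : 0 < Real.sin (2 * h) := by rw [Real.sin_two_mul]; positivity
  have sd : Real.sin h ≤ Real.sin (d * h) := sin_pi_div_le_sin_mul h1' (by linarith)
  have sm : 0 ≤ Real.sin (d * h - h) := by
    have : d * h - h = (d - 1) * h := by ring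
    rw [this]
    exact sin_mul_pi_div_nonneg (by linarith) (by linarith)
  have sp : 0 ≤ Real.sin (d * h + h) := by
    have : d * h + h = (d + 1) * h := by ring
    rw [this]
    exact sin_mul_pi_div_nonneg (by linarith) (by linarith)
  have key := sin_smul_unitVec_sub a h (d * h)
  have hs0 : 0 < Real.sin h * Real.sin (2 * h) := by positivity
  have sd0 : 0 < Real.sin (d * h) := s1.trans_le sd
  refine ⟨Real.sin (d * h) * Real.sin (d * h - h) / (Real.sin h * Real.sin (2 * h)),
    Real.sin (d * h) * Real.sin (d * h + h) / (Real.sin h * Real.sin (2 * h)), by positivity,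
    by positivity, ?_, ?_⟩
  · rw [← add_div, ← mul_add, le_div_iff₀ hs0, one_mul, Real.sin_sub, Real.sin_add,
      Real.sin_two_mul]
    -- The sum α + β equals (sin(dh)/sin h)², which is at least 1.
    have := mul_le_mul sd sd s1.le sd0.le
    nlinarith
  · simp only [regularVertex]
    rw [e1, e2, e3, add_sub_add_left_eq_sub, add_sub_add_left_eq_sub, ← smul_sub, ← smul_sub,
      add_assoc (p + R • _), ← sub_eq_iff_eq_add', add_sub_add_left_eq_sub, ← smul_sub,
      smul_comm _ R, smul_comm _ R, ← smul_add]
    congr 1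
    refine smul_right_injective Plane hs0.ne' ?_
    simp only [smul_add, smul_smul]
    rw [key, mul_div_cancel₀ _ hs0.ne', mul_div_cancel₀ _ hs0.ne']

/-- Side `k` lies on the line at height r. If both ends of side `j` did too, sin((d-1)π/M) and
sin((d+1)π/M) would vanish, forcing sin(dπ/M) cos(π/M) = 0. So at most one endpoint of side `j` is
on that line, and it is the only possible common point. -/
theorem sides_inter_subsingleton [NeZero M] (hM : 3 ≤ M) (hR : 0 < R) {j k : Fin M} (hjk : j ≠ k) :
    (segment ℝ (regularVertex M p R θ (j : ℕ)) (regularVertex M p R θ ((j + 1 : Fin M) : ℕ)) ∩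
      segment ℝ (regularVertex M p R θ (k : ℕ))
        (regularVertex M p R θ ((k + 1 : Fin M) : ℕ))).Subsingleton := by
  have s1 := sin_pi_div_pos (M := M) (by omega)
  have c1 := cos_pi_div_pos hM
  set r := R * Real.cos (Real.pi / M) with hr
  set A := regularVertex M p R θ (j : ℕ) with hA
  set B := regularVertex M p R θ ((j + 1 : Fin M) : ℕ) with hB
  have hval : ∀ x ∈ segment ℝ (regularVertex M p R θ (k : ℕ))
      (regularVertex M p R θ ((k + 1 : Fin M) : ℕ)), sideHeight M p θ (k : ℕ) x = r := by
    rintro _ ⟨s, t, hs, ht, hst, rfl⟩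
    rw [sideHeight_combo' _ _ _ hst, regularVertex_val_add_one, sideHeight_self,
      sideHeight_add_one, ← add_mul, hst, one_mul]
  have hA1 : sideHeight M p θ (k : ℕ) A ≤ r := sideHeight_regularVertex_le hR.le k j
  have hB1 : sideHeight M p θ (k : ℕ) B ≤ r := sideHeight_regularVertex_le hR.le k (j + 1)
  have hne : sideHeight M p θ (k : ℕ) A < r ∨ sideHeight M p θ (k : ℕ) B < r := by
    by_contra! hcon
    have hA2 := le_antisymm hA1 hcon.1
    have hB2 := le_antisymm hB1 hcon.2
    rw [hA, sideHeight_regularVertex, hr, sub_eq_self] at hA2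
    rw [hB, regularVertex_val_add_one, sideHeight_regularVertex, hr, sub_eq_self] at hB2
    set d : ℤ := (j : ℕ) - (k : ℕ) with hd
    have ed : (((j : ℕ) : ℤ) + 1 - ((k : ℕ) : ℤ)) = d + 1 := by rw [hd]; ring
    rw [ed, add_sub_cancel_right] at hB2
    have hj : ((j : ℕ) : ℝ) + 1 ≤ M := by exact_mod_cast j.2
    have hk : ((k : ℕ) : ℝ) + 1 ≤ M := by exact_mod_cast k.2
    have hj0 : (0 : ℝ) ≤ (j : ℕ) := Nat.cast_nonneg _
    have hk0 : (0 : ℝ) ≤ (k : ℕ) := Nat.cast_nonneg _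
    have hdr : (d : ℝ) = (j : ℕ) - (k : ℕ) := by rw [hd]; push_cast; ring
    have hsd : Real.sin (d * (Real.pi / M)) ≠ 0 := by
      rcases lt_or_gt_of_ne hjk with h | h
      · have h' : ((j : ℕ) : ℝ) + 1 ≤ (k : ℕ) := by exact_mod_cast h
        have := sin_mul_pi_div_pos (M := M) (d := -d) (by linarith) (by linarith)
        rw [neg_mul, Real.sin_neg] at this
        linarith
      · have h' : ((k : ℕ) : ℝ) + 1 ≤ (j : ℕ) := by exact_mod_cast h
        exact (sin_mul_pi_div_pos (by linarith) (by linarith)).ne'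
    have h2R : 2 * R ≠ 0 := by positivity
    have z1 := (mul_eq_zero.1 ((mul_eq_zero.1 hA2).resolve_left h2R)).resolve_left hsd
    have z2 := (mul_eq_zero.1 ((mul_eq_zero.1 hB2).resolve_left h2R)).resolve_right hsd
    have e1 : ((d - 1 : ℤ) : ℝ) * (Real.pi / M) = d * (Real.pi / M) - Real.pi / M := by
      push_cast; ring
    have e2 : ((d + 1 : ℤ) : ℝ) * (Real.pi / M) = d * (Real.pi / M) + Real.pi / M := by
      push_cast; ring
    rw [e1, Real.sin_sub] at z1
    rw [e2, Real.sin_add] at z2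
    have : Real.sin (d * (Real.pi / M)) * Real.cos (Real.pi / M) = 0 := by linarith
    exact (mul_ne_zero hsd c1.ne') this
  have hend : ∀ x ∈ segment ℝ A B, sideHeight M p θ (k : ℕ) x = r →
      x = if sideHeight M p θ (k : ℕ) A < r then B else A := by
    rintro _ ⟨s, t, hs, ht, hst, rfl⟩ hx
    rw [sideHeight_combo' _ _ _ hst] at hx
    have hsr : s * r + t * r = r := by rw [← add_mul, hst, one_mul]
    split_ifs with hlt
    · have hs0 : s = 0 := by
        by_contra hs0
        have : 0 < s := lt_of_le_of_ne hs (Ne.symm hs0)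
        linarith [mul_lt_mul_of_pos_left hlt this, mul_le_mul_of_nonneg_left hB1 ht]
      obtain rfl : t = 1 := by linarith
      rw [hs0, zero_smul, one_smul, zero_add]
    · have hlt' := hne.resolve_left hlt
      have ht0 : t = 0 := by
        by_contra ht0
        have : 0 < t := lt_of_le_of_ne ht (Ne.symm ht0)
        linarith [mul_lt_mul_of_pos_left hlt' this, mul_le_mul_of_nonneg_left hA1 hs]
      obtain rfl : s = 1 := by linarith
      rw [ht0, zero_smul, one_smul, add_zero]
  rintro x ⟨hx1, hx2⟩ y ⟨hy1, hy2⟩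
  rw [hend x hx1 (hval x hx2), hend y hy1 (hval y hy2)]

theorem isEquilateralPolygon_regularVertex [NeZero M] (hM : 3 ≤ M) (hR : 0 < R) :
    IsEquilateralPolygon (fun k : Fin M => regularVertex M p R θ (k : ℕ))
      (2 * R * Real.sin (Real.pi / M))
      (2 * R * Real.sin (Real.pi / M) * (2 * Real.sin (Real.pi / M))) where
  pos := by
    have := sin_pi_div_pos (M := M) (by omega)
    positivity
  pos' := by
    have := sin_pi_div_pos (M := M) (by omega)
    positivity
  dist_eq k := by
    rw [regularVertex_val_add_one]
    exact dist_regularVertex_add_one (by omega) hR _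
  norm_eq k := by
    simp only [regularVertex_val_add_one, regularVertex_val_sub_one]
    exact norm_regularVertex_sub_add hR _
  frontier_eq := frontier_regularPolygon hM hR
  inter j k hjk := sides_inter_subsingleton hM hR hjk
  cone k j hjk := by
    simp only [regularVertex_val_add_one, regularVertex_val_sub_one]
    have hj := j.2
    have hk := k.2
    have hne : (j : ℕ) ≠ (k : ℕ) := fun e => hjk (Fin.ext e)
    rcases lt_or_gt_of_ne hne with h | h
    -- Adding M brings the index difference into the range from 1 to M - 1.
    · have e : regularVertex M p R θ (j : ℕ) =
          regularVertex M p R θ ((k : ℕ) + ((j : ℕ) + M - (k : ℕ))) := by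
        refine regularVertex_congr (NeZero.pos M) ?_
        have : ((k : ℕ) : ℤ) + ((j : ℕ) + M - (k : ℕ)) = (j : ℕ) + M := by ring
        rw [this]
        simp [Int.ModEq]
      rw [e]
      exact regularVertex_mem_cone hM (by omega) (by omega)
    · have e : ((j : ℕ) : ℤ) = (k : ℕ) + ((j : ℕ) - (k : ℕ)) := by ring
      rw [e]
      exact regularVertex_mem_cone hM (by omega) (by omega)

end

/-! ### The two-sided bound. -/

theorem corollary3 :
    ∃ c C : ℝ, 0 < c ∧ 0 < C ∧
      ∀ (M : ℕ), 4 ≤ M → ∀ (Q : Set Plane), IsRegularPolygon M Q →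
        ∃ L : ℝ,
          c * (boundaryLength Q * (Real.log M / M)) ≤ L ∧
          L ≤ C * (boundaryLength Q * (Real.log M / M)) ∧
          ∀ (Ω : ℕ → Type*) [∀ n, MeasurableSpace (Ω n)]
            (P : ∀ n, MeasureTheory.Measure (Ω n))
            [∀ n, MeasureTheory.IsProbabilityMeasure (P n)]
            (X : ∀ n, Fin n → Ω n → Plane),
            (∀ n, IsUniformBoundarySample (P n) Q (X n)) →
              (∀ n, MeasureTheory.Integrable (hullDist Q (X n)) (P n)) ∧
              Filter.Tendsto (fun n : ℕ => (n : ℝ) * ∫ ω, hullDist Q (X n) ω ∂(P n))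
                Filter.atTop (nhds L) := by
  -- With σ = sin(π/M), the lower bound is ℓ log M · σM/4 with σM ≥ 2 by Jordan's inequality. The
  -- upper bound is ℓσM(log M + 1), where σM ≤ π and 1 ≤ log M since M ≥ 4 > e.
  refine ⟨1 / 2, 2 * Real.pi, by norm_num, by positivity, ?_⟩
  rintro M hM _ ⟨p, R, θ, hR, rfl⟩
  have : NeZero M := ⟨by omega⟩
  have hM' : (4 : ℝ) ≤ M := by exact_mod_cast hM
  have hM0 : (0 : ℝ) < M := by linarith
  have hV : (fun k : Fin M => circlePoint p R (θ + 2 * Real.pi * k / M)) =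
      fun k : Fin M => regularVertex M p R θ (k : ℕ) := by
    funext k
    rw [circlePoint_eq, regularVertex]
    congr 3
    push_cast
    ring
  rw [hV]
  have h := isEquilateralPolygon_regularVertex (M := M) (p := p) (R := R) (θ := θ) (by omega) hR
  set V := fun k : Fin M => regularVertex M p R θ (k : ℕ) with hVdef
  set σ := Real.sin (Real.pi / M) with hσ
  set ℓ := 2 * R * σ with hℓ
  have hσ0 : 0 < σ := sin_pi_div_pos (by omega)
  have hℓ0 : 0 < ℓ := h.pos
  have hr : (0 : ℝ) < 1 / M := by positivity
  have hσ1 : σ ≤ Real.pi / M := Real.sin_le (by positivity)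
  have hσ2 : 2 / M ≤ σ := by
    have := Real.mul_le_sin (x := Real.pi / M) (by positivity)
      (div_le_div_of_nonneg_left Real.pi_pos.le two_pos (by linarith))
    have e : 2 / Real.pi * (Real.pi / M) = 2 / M := by field_simp
    rwa [e] at this
  have hlog : 1 ≤ Real.log M := by
    rw [Real.le_log_iff_exp_le hM0]
    linarith [Real.exp_one_lt_d9]
  have hbl : boundaryLength (convexHull ℝ (range V)) * (Real.log M / M) = ℓ * Real.log M := by
    rw [h.boundaryLength_eq]
    field_simp
  rw [hbl]
  have heq : ∀ k, ‖V (k - 1) - V k‖ = ‖V (k + 1) - V k‖ := fun k => by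
    rw [← dist_eq_norm, ← dist_eq_norm, dist_comm, dist_comm (V (k + 1))]
    exact (h.dist_adjacent (k, false)).trans (h.dist_adjacent (k, true)).symm
  refine ⟨_, ?_, ?_, fun Ω _ P _ X hX =>
    ⟨fun n => IsEquilateralPolygon.integrable_hullDist (hX n), h.tendsto_integral_hullDist hX⟩⟩
  · refine le_trans ?_ (le_integral_maxCornerDist h.pos' h.norm_eq heq hr)
    rw [Fintype.card_fin]
    have e : ℓ * (2 * σ) / (8 * (1 / M)) * Real.log M = ℓ * Real.log M * (σ * M / 4) := by
      field_simp
      ring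
    rw [e]
    have h2 : 2 ≤ σ * M := by rwa [div_le_iff₀ hM0] at hσ2
    have h3 : 0 ≤ ℓ * Real.log M := by positivity
    nlinarith
  · refine (integrable_and_integral_maxCornerDist_le h.pos' h.norm_eq hr).2.trans ?_
    rw [Fintype.card_fin]
    have e : ℓ * (2 * σ) / (2 * (1 / M)) = ℓ * (σ * M) := by
      field_simp
    rw [e]
    have h2 : σ * M ≤ Real.pi := by rwa [le_div_iff₀ hM0] at hσ1
    have h3 : 0 ≤ ℓ * (σ * M) := by positivity
    calc ℓ * (σ * M) * (Real.log M + 1) ≤ ℓ * (σ * M) * (2 * Real.log M) := by gcongr; linarith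
      _ ≤ ℓ * Real.pi * (2 * Real.log M) := by gcongr
      _ = _ := by ring
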